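/- For a real $2\times 2$ matrix $A$ let $\sigma_1(A)\ge\sigma_2(A)\ge 0$ be its singular values (the square roots of the eigenvalues of $A^{T}A$), let $\|A\|$ be its operator norm with respect to the Euclidean norm on $\mathbb{R}^2$, and for $s>0$ put \[ \varphi^s(A)=\begin{cases}\sigma_1(A)^s,&0<s\le 1,\\ \sigma_1(A)\,\sigma_2(A)^{s-1},&1\le s\le 2,\\ |\det A|^{s/2},&s\ge 2,\end{cases} \] with $0^0=1$. Let $B=\{A\in M_2(\mathbb{R}):\|A\|\le 1\}$. For a finite Borel measure $\nu$ on $B$ and $s>0$ define the singular value pressure \[ \mathbf{P}(\nu,s)=\lim_{n\to\infty}\frac1n\log\int\varphi^s(A_1\cdots A_n)\,d\nu(A_1)\cdots d\nu(A_n),\qquad \log 0=-\infty . \] This limit exists in $[-\infty,+\infty)$. Let $\mathcal{M}_2$ be the set of Borel probability measures on $B$ with the weak-$*$ topology, and for $\mu\in\mathcal{M}_2$ let $\mu^0$ be the measure on $B$ given by $\mu^0(X)=\mu(\{A\in X:\det A\neq 0\})$. Theorem. The function $\mathbf{P}\colon\mathcal{M}_2\times(0,+\infty)\to[-\infty,+\infty)$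 is discontinuous at $(\mu,s)$ if and only if $s=1$ and $\mathbf{P}(\mu,1)>\mathbf{P}(\mu^0,1)$. -/

import Mathlib

open MeasureTheory Filter Topology

noncomputable section

/-- The Borel sigma-algebra on the space of real `d × d` matrices. -/
instance matrixBorelMeasurableSpace (d : ℕ) : MeasurableSpace (Matrix (Fin d) (Fin d) ℝ) :=
  borel _

instance matrixBorelSpace (d : ℕ) : BorelSpace (Matrix (Fin d) (Fin d) ℝ) := ⟨rfl⟩

/-- The singular values of a real square matrix in decreasing order, counted from `0`: they are the
square roots of the eigenvalues of `Aᵀ * A`, with multiplicity. -/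
def singVal {d : ℕ} (A : Matrix (Fin d) (Fin d) ℝ) (i : ℕ) : ℝ :=
  (Matrix.toEuclideanLin A).singularValues i

/-- The singular value function: with `σ₁ ≥ … ≥ σ_d` the singular values of `A`, it equals
`σ₁ ⋯ σ_k * σ_{k+1} ^ (s - k)` for `k = ⌊s⌋` if `0 ≤ s < d` (where `0 ^ 0 = 1`), and
`|det A| ^ (s / d)` if `d ≤ s`. -/
def singValFun {d : ℕ} (s : ℝ) (A : Matrix (Fin d) (Fin d) ℝ) : ℝ :=
  if (d : ℝ) ≤ s then |A.det| ^ (s / d)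
  else (∏ i ∈ Finset.range ⌊s⌋₊, singVal A i) * singVal A ⌊s⌋₊ ^ (s - (⌊s⌋₊ : ℝ))

/-- The law of the product `A₁ ⋯ Aₙ` when `(A₁, …, Aₙ)` is distributed according to
`μ × ⋯ × μ`. -/
def productLaw {d : ℕ} (μ : Measure (Matrix (Fin d) (Fin d) ℝ)) (n : ℕ) :
    Measure (Matrix (Fin d) (Fin d) ℝ) :=
  (Measure.pi fun _ : Fin n => μ).map fun A => (List.ofFn A).prod

/-- `(1 / n) * log ∫ φ^s dμₙ`, an extended real number (`log 0 = -∞`). -/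
def pressureSeq {d : ℕ} (μ : Measure (Matrix (Fin d) (Fin d) ℝ)) (s : ℝ) (n : ℕ) : EReal :=
  ENNReal.log (∫⁻ A, ENNReal.ofReal (singValFun s A) ∂(productLaw μ n)) / (n : EReal)

/-- The singular value pressure `P(μ, s) = lim (1 / n) * log ∫ φ^s dμₙ`. -/
def pressure {d : ℕ} (μ : Measure (Matrix (Fin d) (Fin d) ℝ)) (s : ℝ) : EReal :=
  limUnder atTop (pressureSeq μ s)

/-- The closed unit ball of the space of `d × d` real matrices, for the operator norm induced by
the Euclidean norm. -/
def matrixBall (d : ℕ) : Set (Matrix (Fin d) (Fin d) ℝ) :=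
  {A | ‖Matrix.toEuclideanCLM (𝕜 := ℝ) A‖ ≤ 1}

/-- A measure on the closed unit ball, regarded as a measure on the space of all matrices. -/
def extendBall {d : ℕ} (ν : Measure (matrixBall d)) : Measure (Matrix (Fin d) (Fin d) ℝ) :=
  ν.map Subtype.val

/-- The measure `ν⁰ : X ↦ ν {A ∈ X | det A ≠ 0}`. -/
def invertiblePart {d : ℕ} (ν : Measure (matrixBall d)) : Measure (matrixBall d) :=
  ν.restrict {A | A.1.det ≠ 0}

end

/-! Upper semicontinuity holds everywhere. By submultiplicativity the pressure is an infimum over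
`n` of quantities that are weak-* continuous in the measure and left-continuous in `s`; since it is
also nonincreasing in `s`, one exponent slightly below `s` controls a whole neighbourhood.

The content is lower semicontinuity for exponents `t ≤ 1`, where φ^t is a power of the norm. If a
continuous homogeneous `F ≠ 0` satisfies `lam * F v ^ t ≤ ∫ F (A v) ^ t dν(A)`, iteration gives
pressure at least `log lam`. Conversely, below the pressure such an `F` exists with the inequality
strict on the unit circle, up to a correction that lives where `F` vanishes. Strictness on a compact
set survives perturbation of ν and `t`. To find `F`, consider the series ∑ lam^(-i) ∫ ‖M v‖^t
dν_i(M), where ν_i is the law of the `i`-fold product. The vectors where it converges form an almost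
surely invariant proper subspace of the plane. If this is zero, a root of a partial sum serves as
`F`; if it is a line, ν is triangular and `F` is explicit (`exists_isTestPair`,
`eventually_lt_pressure`).

For `1 < s < 2`, φ^s is ‖A‖^(2-s) |det A|^(s-1); the determinant is multiplicative, so the pressure
at `s` is that of |det|^(s-1) dμ at exponent `2 - s`, which lies in (0,1). For `s ≥ 2` the pressure
is an explicit integral. As `s` decreases to 1 the weights tend to the indicator of the invertible
matrices, so the right limit at 1 is P(μ⁰,1). This is the only possible failure of lower
semicontinuity. Joint lower semicontinuity follows by moving to some `s₁ > s`, perturbing the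
measure there, and using monotonicity in `s`. -/

open scoped NNReal ENNReal

/-! ### Singular values and the singular value function in dimension two -/

noncomputable section SingularValues

/-- The operator on the Euclidean plane given by a matrix. -/
abbrev planeMap (A : Matrix (Fin 2) (Fin 2) ℝ) :
    EuclideanSpace ℝ (Fin 2) →L[ℝ] EuclideanSpace ℝ (Fin 2) :=
  Matrix.toEuclideanCLM (𝕜 := ℝ) A

theorem continuous_planeMap : Continuous planeMap :=
  LinearMap.continuous_of_finiteDimensional
    (Matrix.toEuclideanCLM (n := Fin 2) (𝕜 := ℝ)).toAlgEquiv.toLinearMap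

theorem planeMap_mul_apply (A B : Matrix (Fin 2) (Fin 2) ℝ) (v : EuclideanSpace ℝ (Fin 2)) :
    planeMap (A * B) v = planeMap A (planeMap B v) := by
  simp [planeMap]

theorem planeMap_one_apply (v : EuclideanSpace ℝ (Fin 2)) : planeMap 1 v = v := by
  simp [planeMap]

theorem norm_planeMap_mul_le (A B : Matrix (Fin 2) (Fin 2) ℝ) :
    ‖planeMap (A * B)‖ ≤ ‖planeMap A‖ * ‖planeMap B‖ := by
  rw [planeMap, map_mul]; exact norm_mul_le _ _

theorem singVal_nonneg {d : ℕ} (A : Matrix (Fin d) (Fin d) ℝ) (i : ℕ) : 0 ≤ singVal A i :=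
  LinearMap.singularValues_nonneg _ _

theorem singVal_antitone {d : ℕ} (A : Matrix (Fin d) (Fin d) ℝ) : Antitone (singVal A) :=
  LinearMap.singularValues_antitone _

/-- In an orthonormal eigenbasis of `Aᵀ A`, ‖A v‖² is the sum of squared coordinates weighted by the
eigenvalues; the top eigenvector attains the bound. -/
theorem singVal_zero_eq_norm (A : Matrix (Fin 2) (Fin 2) ℝ) : singVal A 0 = ‖planeMap A‖ := by
  set T := Matrix.toEuclideanLin A with hT
  have hn : Module.finrank ℝ (EuclideanSpace ℝ (Fin 2)) = 2 := by simp
  have hAT : ∀ v, planeMap A v = T v := fun v => rfl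
  have hS := T.isSymmetric_adjoint_comp_self
  have hsq : ∀ i : Fin 2, hS.eigenvalues hn i = singVal A i ^ 2 := fun i =>
    (T.sq_singularValues_fin hn i).symm
  have hnorm : ∀ v, ‖T v‖ ^ 2 = inner ℝ (T.adjoint (T v)) v := fun v => by
    rw [LinearMap.adjoint_inner_left, real_inner_self_eq_norm_sq]
  apply le_antisymm
  · set b := hS.eigenvectorBasis hn 0
    have hb : ‖b‖ = 1 := (hS.eigenvectorBasis hn).orthonormal.1 0
    have h1 : T.adjoint (T b) = (hS.eigenvalues hn 0) • b := hS.apply_eigenvectorBasis hn 0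
    have h2 : ‖T b‖ ^ 2 = singVal A 0 ^ 2 := by
      rw [hnorm, h1, inner_smul_left, real_inner_self_eq_norm_sq, hb, hsq]; simp
    have h3 : ‖T b‖ = singVal A 0 :=
      (sq_eq_sq₀ (norm_nonneg _) (singVal_nonneg _ _)).1 h2
    have := (planeMap A).le_opNorm b
    rw [hAT, h3, hb, mul_one] at this
    exact this
  · refine ContinuousLinearMap.opNorm_le_bound _ (singVal_nonneg _ _) fun v => ?_
    rw [hAT]
    refine le_of_sq_le_sq ?_ (mul_nonneg (singVal_nonneg _ _) (norm_nonneg _))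
    set b := hS.eigenvectorBasis hn
    have key : ‖T v‖ ^ 2 = ∑ i : Fin 2, singVal A i ^ 2 * (inner ℝ (b i) v) ^ 2 := by
      rw [hnorm, ← b.sum_inner_mul_inner]
      refine Finset.sum_congr rfl fun i _ => ?_
      have h1 : T.adjoint (T (b i)) = (hS.eigenvalues hn i) • b i := hS.apply_eigenvectorBasis hn i
      have h2 : inner ℝ (T.adjoint (T v)) (b i) = inner ℝ v (T.adjoint (T (b i))) := hS v (b i)
      rw [h2, h1, inner_smul_right, hsq, real_inner_comm v (b i)]; ring
    rw [key, mul_pow, ← b.sum_sq_inner_right v, Finset.mul_sum]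
    refine Finset.sum_le_sum fun i _ => ?_
    gcongr
    · exact singVal_nonneg _ _
    · exact singVal_antitone A (Nat.zero_le _)

theorem singVal_zero_mul_one (A : Matrix (Fin 2) (Fin 2) ℝ) :
    singVal A 0 * singVal A 1 = |A.det| := by
  have h := (Matrix.toEuclideanLin A).normDet_eq_prod_singularValues
  have hd : LinearMap.det (Matrix.toEuclideanLin A) = A.det := by
    rw [show Matrix.toEuclideanLin A = Matrix.toLpLin 2 2 A from rfl, Matrix.toLpLin_eq_toLin,
      LinearMap.det_toLin]
  rw [LinearMap.normDet_eq_norm_det, hd] at h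
  simpa [Finset.prod_range_succ, singVal] using h.symm

/-- The exponent of the larger singular value in the singular value function. -/
def expOne (s : ℝ) : ℝ := max (min s 1) (s / 2)

/-- The exponent of the smaller singular value in the singular value function. -/
def expTwo (s : ℝ) : ℝ := min (max (s - 1) 0) (s / 2)

theorem expOne_mono : Monotone expOne := fun a b h => by unfold expOne; gcongr
theorem expTwo_mono : Monotone expTwo := fun a b h => by unfold expTwo; gcongr
theorem expOne_continuous : Continuous expOne := by unfold expOne; fun_prop
theorem expTwo_continuous : Continuous expTwo := by unfold expTwo; fun_prop
theorem expOne_pos {s : ℝ} (hs : 0 < s) : 0 < expOne s :=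
  lt_max_of_lt_right (by positivity)
theorem expTwo_nonneg {s : ℝ} (hs : 0 < s) : 0 ≤ expTwo s :=
  le_min (le_max_right _ _) (by positivity)

theorem expOne_eq_self {s : ℝ} (hs : 0 < s) (h1 : s ≤ 1) : expOne s = s := by
  rw [expOne, min_eq_left h1, max_eq_left (by linarith)]
theorem expOne_eq_one {s : ℝ} (hs : 1 ≤ s) (h1 : s ≤ 2) : expOne s = 1 := by
  rw [expOne, min_eq_right hs, max_eq_left (by linarith)]
theorem expOne_eq_half {s : ℝ} (hs : 2 ≤ s) : expOne s = s / 2 := by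
  rw [expOne, min_eq_right (by linarith), max_eq_right (by linarith)]
theorem expTwo_eq_zero {s : ℝ} (hs : 0 < s) (h1 : s ≤ 1) : expTwo s = 0 := by
  rw [expTwo, max_eq_right (by linarith), min_eq_left (by linarith)]
theorem expTwo_eq_sub {s : ℝ} (hs : 1 ≤ s) (h1 : s ≤ 2) : expTwo s = s - 1 := by
  rw [expTwo, max_eq_left (by linarith), min_eq_left (by linarith)]
theorem expTwo_eq_half {s : ℝ} (hs : 2 ≤ s) : expTwo s = s / 2 := by
  rw [expTwo, max_eq_left (by linarith), min_eq_right (by linarith)]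

/-- A single formula for all regimes: both exponents are continuous and nondecreasing in `s`, which
yields monotonicity and left-continuity. -/
theorem singValFun_eq {s : ℝ} (hs : 0 < s) (A : Matrix (Fin 2) (Fin 2) ℝ) :
    singValFun s A = singVal A 0 ^ expOne s * singVal A 1 ^ expTwo s := by
  unfold singValFun
  rcases le_or_gt 2 s with h2 | h2
  · rw [if_pos (by exact_mod_cast h2), expOne_eq_half h2, expTwo_eq_half h2,
      ← Real.mul_rpow (singVal_nonneg _ _) (singVal_nonneg _ _), singVal_zero_mul_one]
    norm_num
  rw [if_neg (by push_cast; linarith)]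
  rcases lt_or_ge s 1 with h1 | h1
  · have hf : ⌊s⌋₊ = 0 := Nat.floor_eq_zero.2 h1
    rw [hf, expOne_eq_self hs h1.le, expTwo_eq_zero hs h1.le]
    simp
  · have hf : ⌊s⌋₊ = 1 := by
      rw [Nat.floor_eq_iff hs.le]; constructor <;> norm_num <;> linarith
    rw [hf, expOne_eq_one h1 h2.le, expTwo_eq_sub h1 h2.le]
    simp

theorem singValFun_nonneg {s : ℝ} (hs : 0 < s) (A : Matrix (Fin 2) (Fin 2) ℝ) :
    0 ≤ singValFun s A := by
  rw [singValFun_eq hs]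
  exact mul_nonneg (Real.rpow_nonneg (singVal_nonneg _ _) _)
    (Real.rpow_nonneg (singVal_nonneg _ _) _)

theorem singValFun_of_le_one {s : ℝ} (hs : 0 < s) (h1 : s ≤ 1) (A : Matrix (Fin 2) (Fin 2) ℝ) :
    singValFun s A = ‖planeMap A‖ ^ s := by
  rw [singValFun_eq hs, expOne_eq_self hs h1, expTwo_eq_zero hs h1, singVal_zero_eq_norm]
  simp

/-- Splitting off the multiplicative factor |det|^(s-1) leaves a norm power with exponent in (0,1].
The condition `s < 2` makes both sides vanish at `A = 0`, even for `s = 1`. -/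
theorem singValFun_of_one_le {s : ℝ} (hs : 1 ≤ s) (h2 : s < 2) (A : Matrix (Fin 2) (Fin 2) ℝ) :
    singValFun s A = ‖planeMap A‖ ^ (2 - s) * |A.det| ^ (s - 1) := by
  rw [singValFun_eq (by linarith), expOne_eq_one hs h2.le, expTwo_eq_sub hs h2.le,
    ← singVal_zero_mul_one, Real.mul_rpow (singVal_nonneg _ _) (singVal_nonneg _ _),
    ← singVal_zero_eq_norm, ← mul_assoc]
  congr 1
  rcases (singVal_nonneg A 0).eq_or_lt with h | h
  · rw [← h, Real.zero_rpow (by linarith : 2 - s ≠ 0)]; simp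
  · rw [← Real.rpow_add h]; norm_num

theorem singValFun_of_two_le {s : ℝ} (hs : 2 ≤ s) (A : Matrix (Fin 2) (Fin 2) ℝ) :
    singValFun s A = |A.det| ^ (s / 2) := by
  unfold singValFun
  rw [if_pos (by exact_mod_cast hs)]; norm_num

theorem continuous_singValFun {s : ℝ} (hs : 0 < s) :
    Continuous (singValFun (d := 2) s) := by
  have hdet : Continuous fun A : Matrix (Fin 2) (Fin 2) ℝ => |A.det| :=
    (Continuous.matrix_det continuous_id).abs
  have hn : Continuous fun A : Matrix (Fin 2) (Fin 2) ℝ => ‖planeMap A‖ :=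
    continuous_planeMap.norm
  rcases le_or_gt s 1 with h1 | h1
  · rw [funext (singValFun_of_le_one hs h1)]
    exact hn.rpow_const fun _ => Or.inr hs.le
  rcases lt_or_ge s 2 with h2 | h2
  · rw [funext (singValFun_of_one_le h1.le h2)]
    exact (hn.rpow_const fun _ => Or.inr (by linarith)).mul
      (hdet.rpow_const fun _ => Or.inr (by linarith))
  · rw [funext (singValFun_of_two_le h2)]
    exact hdet.rpow_const fun _ => Or.inr (by linarith)

theorem singValFun_mul_le {s : ℝ} (hs : 0 < s) (A B : Matrix (Fin 2) (Fin 2) ℝ) :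
    singValFun s (A * B) ≤ singValFun s A * singValFun s B := by
  have hn : ∀ t : ℝ, 0 ≤ t →
      ‖planeMap (A * B)‖ ^ t ≤ ‖planeMap A‖ ^ t * ‖planeMap B‖ ^ t := fun t ht => by
    rw [← Real.mul_rpow (norm_nonneg _) (norm_nonneg _)]
    exact Real.rpow_le_rpow (norm_nonneg _) (norm_planeMap_mul_le A B) ht
  have hd : ∀ t : ℝ, |(A * B).det| ^ t = |A.det| ^ t * |B.det| ^ t := fun t => by
    rw [Matrix.det_mul, abs_mul, Real.mul_rpow (abs_nonneg _) (abs_nonneg _)]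
  rcases le_or_gt s 1 with h1 | h1
  · simp only [singValFun_of_le_one hs h1]
    exact hn s hs.le
  rcases lt_or_ge s 2 with h2 | h2
  · simp only [singValFun_of_one_le h1.le h2, hd]
    calc _ ≤ (‖planeMap A‖ ^ (2 - s) * ‖planeMap B‖ ^ (2 - s)) *
          (|A.det| ^ (s - 1) * |B.det| ^ (s - 1)) := by
            gcongr; exact hn _ (by linarith)
      _ = _ := by ring
  · simp only [singValFun_of_two_le h2, hd]; exact le_rfl

theorem singValFun_one_le_one {s : ℝ} (hs : 0 < s) {A : Matrix (Fin 2) (Fin 2) ℝ}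
    (hA : ‖planeMap A‖ ≤ 1) : singValFun s A ≤ 1 := by
  have h0 : singVal A 0 ≤ 1 := by rwa [singVal_zero_eq_norm]
  have h1 : singVal A 1 ≤ 1 := (singVal_antitone A zero_le_one).trans h0
  rw [singValFun_eq hs]
  exact mul_le_one₀ (Real.rpow_le_one (singVal_nonneg _ _) h0 (expOne_pos hs).le)
    (Real.rpow_nonneg (singVal_nonneg _ _) _)
    (Real.rpow_le_one (singVal_nonneg _ _) h1 (expTwo_nonneg hs))

theorem singValFun_antitone {s s' : ℝ} (hs : 0 < s) (h : s ≤ s') {A : Matrix (Fin 2) (Fin 2) ℝ}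
    (hA : ‖planeMap A‖ ≤ 1) : singValFun s' A ≤ singValFun s A := by
  have h0 : singVal A 0 ≤ 1 := by rwa [singVal_zero_eq_norm]
  have h1 : singVal A 1 ≤ 1 := (singVal_antitone A zero_le_one).trans h0
  rw [singValFun_eq hs, singValFun_eq (hs.trans_le h)]
  exact mul_le_mul
    (Real.rpow_le_rpow_of_exponent_ge' (singVal_nonneg _ _) h0 (expOne_pos hs).le (expOne_mono h))
    (Real.rpow_le_rpow_of_exponent_ge' (singVal_nonneg _ _) h1 (expTwo_nonneg hs) (expTwo_mono h))
    (Real.rpow_nonneg (singVal_nonneg _ _) _) (Real.rpow_nonneg (singVal_nonneg _ _) _)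

theorem abs_det_le_one {A : Matrix (Fin 2) (Fin 2) ℝ} (hA : ‖planeMap A‖ ≤ 1) : |A.det| ≤ 1 := by
  have h0 : singVal A 0 ≤ 1 := by rwa [singVal_zero_eq_norm]
  rw [← singVal_zero_mul_one]
  exact mul_le_one₀ h0 (singVal_nonneg _ _) ((singVal_antitone A zero_le_one).trans h0)

/-- Only the left limit exists in general with the right value: just above 1 the exponent of σ₂
becomes positive, so a singular `A ≠ 0` drops from ‖A‖ to 0. Up to 1 that exponent is constantly 0.
-/
theorem tendsto_singValFun_nhdsLT {s : ℝ} (hs : 0 < s) (A : Matrix (Fin 2) (Fin 2) ℝ) :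
    Tendsto (fun s' => singValFun s' A) (𝓝[<] s) (𝓝 (singValFun s A)) := by
  have hpos : ∀ᶠ s' in 𝓝[<] s, 0 < s' :=
    eventually_nhdsWithin_of_eventually_nhds (lt_mem_nhds hs)
  rw [singValFun_eq hs]
  refine Tendsto.congr' (f₁ := fun s' => singVal A 0 ^ expOne s' * singVal A 1 ^ expTwo s') ?_ ?_
  · filter_upwards [hpos] with s' h using (singValFun_eq h A).symm
  refine Tendsto.mul ?_ ?_
  · exact tendsto_const_nhds.rpow (expOne_continuous.tendsto' s _ rfl |>.mono_left
      nhdsWithin_le_nhds) (Or.inr (expOne_pos hs))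
  · rcases le_or_gt s 1 with h1 | h1
    · refine Tendsto.congr' (f₁ := fun _ => singVal A 1 ^ expTwo s) ?_ tendsto_const_nhds
      filter_upwards [hpos, self_mem_nhdsWithin] with s' h h'
      rw [expTwo_eq_zero hs h1, expTwo_eq_zero h ((le_of_lt h').trans h1)]
    · refine tendsto_const_nhds.rpow (expTwo_continuous.tendsto' s _ rfl |>.mono_left
        nhdsWithin_le_nhds) (Or.inr ?_)
      exact lt_min (lt_max_of_lt_left (by linarith)) (by linarith)

end SingularValues

/-! ### Laws of random products -/

noncomputable section ProductLaw

/-- Real `2 × 2` matrices. -/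
abbrev Mat := Matrix (Fin 2) (Fin 2) ℝ

instance : SecondCountableTopology Mat :=
  inferInstanceAs (SecondCountableTopology (Fin 2 → Fin 2 → ℝ))

instance : TopologicalSpace.PseudoMetrizableSpace Mat :=
  inferInstanceAs (TopologicalSpace.PseudoMetrizableSpace (Fin 2 → Fin 2 → ℝ))

theorem continuous_prod_ofFn (n : ℕ) : Continuous fun A : Fin n → Mat => (List.ofFn A).prod := by
  induction n with
  | zero => simp only [List.ofFn_zero, List.prod_nil]; exact continuous_const
  | succ n ih =>
    simp only [List.ofFn_succ, List.prod_cons]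
    exact (continuous_apply 0).mul (ih.comp (by fun_prop))

theorem measurable_prod_ofFn (n : ℕ) : Measurable fun A : Fin n → Mat => (List.ofFn A).prod :=
  (continuous_prod_ofFn n).measurable

instance (μ : Measure Mat) [IsFiniteMeasure μ] (n : ℕ) : IsFiniteMeasure (productLaw μ n) := by
  unfold productLaw; infer_instance

theorem productLaw_zero (μ : Measure Mat) [IsFiniteMeasure μ] :
    productLaw μ 0 = Measure.dirac 1 := by
  unfold productLaw
  rw [Measure.pi_of_empty]
  refine (Measure.map_dirac' (measurable_prod_ofFn 0) _).trans ?_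
  simp

theorem lintegral_productLaw_succ (μ : Measure Mat) [IsFiniteMeasure μ] (n : ℕ) {g : Mat → ℝ≥0∞}
    (hg : Measurable g) :
    ∫⁻ M, g M ∂(productLaw μ (n + 1)) = ∫⁻ A, ∫⁻ M, g (A * M) ∂(productLaw μ n) ∂μ := by
  have hmp := (measurePreserving_piFinSuccAbove (fun _ : Fin (n + 1) => μ) 0).symm
  unfold productLaw
  have hgn : Measurable fun A : Fin (n + 1) → Mat => g (List.ofFn A).prod :=
    hg.comp (measurable_prod_ofFn _)
  rw [lintegral_map hg (measurable_prod_ofFn _), ← hmp.lintegral_comp hgn]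
  rw [lintegral_prod]
  · refine lintegral_congr fun A => ?_
    rw [lintegral_map (by fun_prop) (measurable_prod_ofFn _)]
    refine lintegral_congr fun B => ?_
    simp [List.ofFn_succ, MeasurableEquiv.piFinSuccAbove]
  · exact (hgn.comp (MeasurableEquiv.measurable _)).aemeasurable

theorem measurable_lintegral_mul (ν : Measure Mat) [IsFiniteMeasure ν] {g : Mat → ℝ≥0∞}
    (hg : Measurable g) : Measurable fun A => ∫⁻ M, g (A * M) ∂ν :=
  Measurable.lintegral_prod_right' (f := fun p : Mat × Mat => g (p.1 * p.2))
    (hg.comp measurable_mul)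

theorem lintegral_productLaw_add (μ : Measure Mat) [IsFiniteMeasure μ] (m n : ℕ) {g : Mat → ℝ≥0∞}
    (hg : Measurable g) :
    ∫⁻ M, g M ∂(productLaw μ (m + n)) =
      ∫⁻ A, ∫⁻ M, g (A * M) ∂(productLaw μ n) ∂(productLaw μ m) := by
  induction m generalizing g with
  | zero =>
    rw [productLaw_zero, lintegral_dirac' _ (measurable_lintegral_mul _ hg)]
    simp
  | succ m ih =>
    rw [show m + 1 + n = (m + n) + 1 by ring, lintegral_productLaw_succ _ _ hg,
      lintegral_productLaw_succ _ _ (measurable_lintegral_mul _ hg)]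
    refine lintegral_congr fun A => ?_
    have hgA : Measurable fun M => g (A * M) := hg.comp (measurable_const_mul A)
    rw [ih hgA]
    simp [mul_assoc]

theorem productLaw_one (μ : Measure Mat) [IsFiniteMeasure μ] : productLaw μ 1 = μ := by
  refine Measure.ext_of_lintegral _ fun g hg => ?_
  rw [lintegral_productLaw_succ μ 0 hg, productLaw_zero]
  refine lintegral_congr fun A => ?_
  have hgA : Measurable fun M => g (A * M) := hg.comp (measurable_const_mul A)
  rw [lintegral_dirac' _ hgA, mul_one]

theorem lintegral_productLaw_succ' (μ : Measure Mat) [IsFiniteMeasure μ] (n : ℕ)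
    {g : Mat → ℝ≥0∞} (hg : Measurable g) :
    ∫⁻ M, g M ∂(productLaw μ (n + 1)) = ∫⁻ A, ∫⁻ M, g (M * A) ∂(productLaw μ n) ∂μ := by
  rw [lintegral_productLaw_add μ n 1 hg, productLaw_one, lintegral_lintegral_swap]
  exact (hg.comp measurable_mul).aemeasurable

theorem ae_productLaw {μ : Measure Mat} [IsFiniteMeasure μ] (hμ : ∀ᵐ A ∂μ, ‖planeMap A‖ ≤ 1)
    (n : ℕ) : ∀ᵐ M ∂(productLaw μ n), ‖planeMap M‖ ≤ 1 := by
  have hmeas : MeasurableSet {M : Mat | ‖planeMap M‖ ≤ 1}ᶜ :=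
    (isClosed_le continuous_planeMap.norm continuous_const).measurableSet.compl
  induction n with
  | zero =>
    rw [productLaw_zero, ae_dirac_iff hmeas.of_compl]
    exact ContinuousLinearMap.opNorm_le_bound _ zero_le_one fun v => by
      rw [planeMap_one_apply, one_mul]
  | succ n ih =>
    have h : ∫⁻ M, ({M : Mat | ‖planeMap M‖ ≤ 1}ᶜ).indicator 1 M ∂(productLaw μ (n + 1)) = 0 := by
      rw [lintegral_productLaw_succ _ _ (measurable_one.indicator hmeas)]
      refine lintegral_eq_zero_of_ae_eq_zero ?_
      filter_upwards [hμ] with A hA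
      refine lintegral_eq_zero_of_ae_eq_zero ?_
      filter_upwards [ih] with M hM
      refine Set.indicator_of_notMem ?_ _
      simp only [Set.mem_compl_iff, Set.mem_ofPred_eq, not_not]
      exact (norm_planeMap_mul_le A M).trans (mul_le_one₀ hA (norm_nonneg _) hM)
    rw [lintegral_indicator_one hmeas] at h
    exact h

/-- Weighting every factor by a multiplicative `w` weights the product by `w`; this is what allows
powers of the determinant to be absorbed into the measure. -/
theorem lintegral_productLaw_withDensity (μ : Measure Mat) [IsFiniteMeasure μ] {w : Mat → ℝ≥0∞}
    (hw : Measurable w) (hw1 : w 1 = 1) (hwm : ∀ A B, w (A * B) = w A * w B)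
    [IsFiniteMeasure (μ.withDensity w)] (n : ℕ) {g : Mat → ℝ≥0∞} (hg : Measurable g) :
    ∫⁻ M, g M ∂(productLaw (μ.withDensity w) n) = ∫⁻ M, w M * g M ∂(productLaw μ n) := by
  have hwg : ∀ {f : Mat → ℝ≥0∞}, Measurable f → Measurable fun M => w M * f M := hw.mul
  induction n generalizing g with
  | zero =>
    rw [productLaw_zero, productLaw_zero, lintegral_dirac' _ hg, lintegral_dirac' _ (hwg hg),
      hw1, one_mul]
  | succ n ih =>
    rw [lintegral_productLaw_succ _ _ hg, lintegral_productLaw_succ _ _ (hwg hg),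
      lintegral_withDensity_eq_lintegral_mul _ hw (measurable_lintegral_mul _ hg)]
    refine lintegral_congr fun A => ?_
    have hgA : Measurable fun M => g (A * M) := hg.comp (measurable_const_mul A)
    rw [Pi.mul_apply, ih hgA, ← lintegral_const_mul _ (hwg hgA)]
    refine lintegral_congr fun M => ?_
    rw [hwm, mul_assoc]

end ProductLaw

/-! ### Fekete's lemma with values in the extended reals -/

noncomputable section Fekete

/-- A zero term forces all later terms to vanish, and the limit is -∞; otherwise the real
subadditive lemma applies. The infimum starts at index one to avoid the division by zero at `n = 0`.
-/
theorem EReal.tendsto_log_div_of_submultiplicative {u : ℕ → ℝ≥0∞}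
    (hu : ∀ m n, u (m + n) ≤ u m * u n) (hfin : ∀ n, u n ≠ ⊤) :
    Tendsto (fun n : ℕ => ENNReal.log (u n) / (n : EReal)) atTop
      (𝓝 (⨅ n : ℕ, ENNReal.log (u (n + 1)) / ((n + 1 : ℕ) : EReal))) := by
  refine tendsto_order.2 ⟨fun a ha => ?_, fun b hb => ?_⟩
  · filter_upwards [eventually_ge_atTop 1] with n hn
    obtain ⟨k, rfl⟩ := Nat.exists_eq_add_of_le' hn
    exact ha.trans_le (iInf_le _ k)
  · obtain ⟨k, hk⟩ := iInf_lt_iff.1 hb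
    by_cases hz : ∃ m, u m = 0
    · obtain ⟨m, hm⟩ := hz
      filter_upwards [eventually_ge_atTop (m + 1)] with n hn
      have : u n = 0 := by
        obtain ⟨j, rfl⟩ := Nat.exists_eq_add_of_le (Nat.le_of_succ_le hn)
        have := hu m j
        rw [hm, zero_mul] at this
        exact le_antisymm this zero_le
      rw [this, ENNReal.log_zero, EReal.bot_div_of_pos_ne_top (by exact_mod_cast (by omega))
        (EReal.natCast_ne_top n)]
      exact bot_le.trans_lt hk
    · push Not at hz
      have hpos : ∀ n, 0 < (u n).toReal := fun n => ENNReal.toReal_pos (hz n) (hfin n)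
      have hlog : ∀ n : ℕ, ENNReal.log (u n) / (n : EReal) =
          ((Real.log (u n).toReal / n : ℝ) : EReal) := fun n => by
        rw [ENNReal.log_pos_real (hz n) (hfin n), EReal.coe_div]; rfl
      have hsub : Subadditive fun n => Real.log (u n).toReal := fun m n => by
        rw [← Real.log_mul (hpos m).ne' (hpos n).ne', ← ENNReal.toReal_mul]
        exact Real.log_le_log (hpos _)
          (ENNReal.toReal_mono (ENNReal.mul_ne_top (hfin m) (hfin n)) (hu m n))
      rw [hlog] at hk
      obtain ⟨c, hc1, hc2⟩ := EReal.lt_iff_exists_real_btwn.1 hk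
      filter_upwards [hsub.eventually_div_lt_of_div_lt (Nat.succ_ne_zero k)
        (EReal.coe_lt_coe_iff.1 hc1)] with n hn
      rw [hlog]
      exact (EReal.coe_lt_coe_iff.2 hn).trans hc2

end Fekete

/-! ### The pressure as an infimum -/

noncomputable section Pressure

/-- The integral of the singular value function against the law of the `n`-fold product. -/
def singValIntegral (μ : Measure Mat) (s : ℝ) (n : ℕ) : ℝ≥0∞ :=
  ∫⁻ A, ENNReal.ofReal (singValFun s A) ∂(productLaw μ n)

theorem pressureSeq_eq (μ : Measure Mat) (s : ℝ) (n : ℕ) :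
    pressureSeq μ s n = ENNReal.log (singValIntegral μ s n) / (n : EReal) := rfl

theorem measurable_ofReal_singValFun {s : ℝ} (hs : 0 < s) :
    Measurable fun A : Mat => ENNReal.ofReal (singValFun s A) :=
  (continuous_singValFun hs).measurable.ennreal_ofReal

theorem pressureSeq_mono_integral {μ μ' : Measure Mat} {s s' : ℝ} {n : ℕ}
    (h : singValIntegral μ' s' n ≤ singValIntegral μ s n) :
    pressureSeq μ' s' n ≤ pressureSeq μ s n := by
  rw [pressureSeq_eq, pressureSeq_eq]
  exact EReal.div_le_div_right_of_nonneg (by positivity) (ENNReal.log_monotone h)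

variable {μ : Measure Mat} [IsFiniteMeasure μ]

theorem singValIntegral_lt_top (hμ : ∀ᵐ A ∂μ, ‖planeMap A‖ ≤ 1) {s : ℝ} (hs : 0 < s) (n : ℕ) :
    singValIntegral μ s n < ⊤ := by
  refine lt_of_le_of_lt (lintegral_mono_ae (g := fun _ => 1) ?_) ?_
  · filter_upwards [ae_productLaw hμ n] with M hM
    exact ENNReal.ofReal_le_one.2 (singValFun_one_le_one hs hM)
  · simp

theorem singValIntegral_add_le {s : ℝ} (hs : 0 < s) (m n : ℕ) :
    singValIntegral μ s (m + n) ≤ singValIntegral μ s m * singValIntegral μ s n := by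
  unfold singValIntegral
  have hm := measurable_ofReal_singValFun hs
  rw [lintegral_productLaw_add _ _ _ hm, ← lintegral_mul_const _ hm]
  refine lintegral_mono fun A => ?_
  rw [← lintegral_const_mul _ hm]
  refine lintegral_mono fun M => ?_
  rw [← ENNReal.ofReal_mul (singValFun_nonneg hs A)]
  exact ENNReal.ofReal_le_ofReal (singValFun_mul_le hs A M)

theorem tendsto_pressureSeq_iInf (hμ : ∀ᵐ A ∂μ, ‖planeMap A‖ ≤ 1) {s : ℝ} (hs : 0 < s) :
    Tendsto (pressureSeq μ s) atTop (𝓝 (⨅ n : ℕ, pressureSeq μ s (n + 1))) :=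
  EReal.tendsto_log_div_of_submultiplicative (singValIntegral_add_le hs)
    fun n => (singValIntegral_lt_top hμ hs n).ne

theorem pressure_eq_iInf (hμ : ∀ᵐ A ∂μ, ‖planeMap A‖ ≤ 1) {s : ℝ} (hs : 0 < s) :
    pressure μ s = ⨅ n : ℕ, pressureSeq μ s (n + 1) :=
  (tendsto_pressureSeq_iInf hμ hs).limUnder_eq

theorem tendsto_pressureSeq (hμ : ∀ᵐ A ∂μ, ‖planeMap A‖ ≤ 1) {s : ℝ} (hs : 0 < s) :
    Tendsto (pressureSeq μ s) atTop (𝓝 (pressure μ s)) := by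
  rw [pressure_eq_iInf hμ hs]; exact tendsto_pressureSeq_iInf hμ hs

theorem pressure_le_pressureSeq (hμ : ∀ᵐ A ∂μ, ‖planeMap A‖ ≤ 1) {s : ℝ} (hs : 0 < s) (n : ℕ) :
    pressure μ s ≤ pressureSeq μ s (n + 1) := by
  rw [pressure_eq_iInf hμ hs]; exact iInf_le _ n

theorem pressure_lt_top (hμ : ∀ᵐ A ∂μ, ‖planeMap A‖ ≤ 1) {s : ℝ} (hs : 0 < s) :
    pressure μ s < ⊤ := by
  refine (pressure_le_pressureSeq hμ hs 0).trans_lt ?_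
  rw [pressureSeq_eq]
  simpa using singValIntegral_lt_top hμ hs 1

theorem singValIntegral_antitone (hμ : ∀ᵐ A ∂μ, ‖planeMap A‖ ≤ 1) {s s' : ℝ} (hs : 0 < s)
    (h : s ≤ s') (n : ℕ) : singValIntegral μ s' n ≤ singValIntegral μ s n := by
  refine lintegral_mono_ae ?_
  filter_upwards [ae_productLaw hμ n] with M hM
  exact ENNReal.ofReal_le_ofReal (singValFun_antitone hs h hM)

theorem pressure_antitone (hμ : ∀ᵐ A ∂μ, ‖planeMap A‖ ≤ 1) {s s' : ℝ} (hs : 0 < s) (h : s ≤ s') :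
    pressure μ s' ≤ pressure μ s := by
  rw [pressure_eq_iInf hμ hs, pressure_eq_iInf hμ (hs.trans_le h)]
  exact iInf_mono fun n => pressureSeq_mono_integral (singValIntegral_antitone hμ hs h _)

end Pressure

/-! ### Lower bounds for the pressure from growth rates -/

noncomputable section Growth

/-- The Euclidean plane. -/
abbrev Plane := EuclideanSpace ℝ (Fin 2)

theorem measurable_planeMap_apply (v : Plane) : Measurable fun M : Mat => planeMap M v :=
  (continuous_planeMap.clm_apply continuous_const).measurable

theorem nnnorm_planeMap_apply_le {A : Mat} (hA : ‖planeMap A‖ ≤ 1) (v : Plane) :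
    ‖planeMap A v‖₊ ≤ ‖v‖₊ :=
  ((planeMap A).le_of_opNorm_le hA v).trans_eq (one_mul _)

theorem singValIntegral_eq_of_le_one (μ : Measure Mat) {t : ℝ} (ht0 : 0 < t) (ht1 : t ≤ 1) (n : ℕ) :
    singValIntegral μ t n = ∫⁻ M, ((‖planeMap M‖₊ ^ t : ℝ≥0) : ℝ≥0∞) ∂(productLaw μ n) := by
  refine lintegral_congr fun M => ?_
  rw [singValFun_of_le_one ht0 ht1, ← ENNReal.ofReal_coe_nnreal, NNReal.coe_rpow, coe_nnnorm]

theorem singValIntegral_le_of_pressureSeq_lt {μ : Measure Mat} {s : ℝ} {n : ℕ} (hn : n ≠ 0)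
    {κ : ℝ≥0∞} (h : pressureSeq μ s n < ENNReal.log κ) : singValIntegral μ s n ≤ κ ^ n := by
  rw [pressureSeq_eq] at h
  have := (EReal.div_le_iff_le_mul (by exact_mod_cast Nat.pos_of_ne_zero hn)
    (EReal.natCast_ne_top n)).1 h.le
  rwa [← ENNReal.log_pow, ENNReal.log_le_log_iff] at this

theorem pow_le_singValIntegral {μ : Measure Mat} [IsFiniteMeasure μ]
    (hμ : ∀ᵐ A ∂μ, ‖planeMap A‖ ≤ 1) {s : ℝ} (hs : 0 < s)
    {κ : ℝ≥0∞} (h : ENNReal.log κ ≤ pressure μ s) (n : ℕ) :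
    κ ^ (n + 1) ≤ singValIntegral μ s (n + 1) := by
  have := h.trans (pressure_le_pressureSeq hμ hs n)
  rw [pressureSeq_eq, EReal.le_div_iff_mul_le (by exact_mod_cast Nat.succ_pos n)
    (EReal.natCast_ne_top _), mul_comm, ← ENNReal.log_pow, ENNReal.log_le_log_iff] at this
  exact this

variable {ν : Measure Mat} [IsFiniteMeasure ν]

/-- Exponential lower bounds for the integrals are lower bounds for the pressure. -/
theorem log_le_pressure (hν : ∀ᵐ A ∂ν, ‖planeMap A‖ ≤ 1) {s : ℝ} (hs : 0 < s) {lam c K : ℝ≥0∞}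
    (hc : c ≠ 0) (hK : K ≠ ⊤) (h : ∀ n, lam ^ n * c ≤ K * singValIntegral ν s n) :
    ENNReal.log lam ≤ pressure ν s := by
  by_contra! hlt
  obtain ⟨x, hx1, hx2⟩ := exists_between hlt
  obtain ⟨κ, rfl⟩ := ENNReal.log_surjective x
  rw [ENNReal.log_lt_log_iff] at hx2
  obtain ⟨lam', h1, h2⟩ := exists_between hx2
  have hlam' : lam' ≠ ⊤ := h2.ne_top
  have hlam0 : lam' ≠ 0 := (bot_le.trans_lt h1).ne'
  -- If the pressure were below `log κ` with `κ < lam' < lam`, the lower bound would trap the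
  -- nonzero `c` under a sequence tending to 0. The intermediate `lam'` is finite and nonzero, so
  -- division by it is harmless.
  have hev : ∀ᶠ n : ℕ in atTop, c ≤ K * (κ / lam') ^ n := by
    filter_upwards [(tendsto_pressureSeq hν hs).eventually (gt_mem_nhds hx1),
      eventually_ne_atTop 0] with n hn hn0
    have h3 : lam' ^ n * c ≤ K * κ ^ n := calc
      lam' ^ n * c ≤ lam ^ n * c := by gcongr
      _ ≤ _ := h n
      _ ≤ _ := by gcongr; exact singValIntegral_le_of_pressureSeq_lt hn0 hn
    rw [ENNReal.div_eq_inv_mul, mul_pow, ← mul_assoc, mul_comm K, mul_assoc, ← ENNReal.inv_pow,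
      ← ENNReal.div_eq_inv_mul, ENNReal.le_div_iff_mul_le (Or.inl (pow_ne_zero _ hlam0))
      (Or.inl (ENNReal.pow_ne_top hlam')), mul_comm c]
    exact h3
  have hlim : Tendsto (fun n : ℕ => K * (κ / lam') ^ n) atTop (𝓝 (K * 0)) :=
    ENNReal.Tendsto.const_mul (ENNReal.tendsto_pow_atTop_nhds_zero_of_lt_one
      ((ENNReal.div_lt_iff (Or.inl hlam0) (Or.inl hlam')).2 (by rwa [one_mul]))) (Or.inr hK)
  have := ge_of_tendsto hlim hev
  rw [mul_zero] at this
  exact hc (le_antisymm this bot_le)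

theorem exists_le_mul_nnnorm {F : Plane → ℝ≥0} (hF : Continuous F)
    (hhom : ∀ (a : ℝ) v, F (a • v) = ‖a‖₊ * F v) : ∃ C : ℝ≥0, ∀ v, F v ≤ C * ‖v‖₊ := by
  obtain ⟨C, hC⟩ := ((isCompact_sphere (0 : Plane) 1).image hF).bddAbove
  refine ⟨C, fun v => ?_⟩
  rcases eq_or_ne v 0 with rfl | hv
  · have := hhom 0 0
    simp at this
    simp [this]
  · have h1 : v = ‖v‖ • ((‖v‖)⁻¹ • v) := by
      rw [smul_smul, mul_inv_cancel₀ (norm_ne_zero_iff.2 hv), one_smul]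
    have h2 : F ((‖v‖)⁻¹ • v) ≤ C := by
      refine hC ⟨_, ?_, rfl⟩
      simp [norm_smul, hv]
    conv_lhs => rw [h1, hhom]
    rw [nnnorm_norm, mul_comm]
    gcongr

/-- A homogeneous supersolution bounds the pressure from below. -/
theorem log_le_pressure_of_superharmonic (hν : ∀ᵐ A ∂ν, ‖planeMap A‖ ≤ 1) {t : ℝ} (ht0 : 0 < t)
    (ht1 : t ≤ 1) {F : Plane → ℝ≥0} (hF : Continuous F)
    (hhom : ∀ (a : ℝ) v, F (a • v) = ‖a‖₊ * F v) (hne : ∃ v, F v ≠ 0) {lam : ℝ≥0∞}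
    (h : ∀ v, lam * (F v ^ t : ℝ≥0) ≤ ∫⁻ A, ((F (planeMap A v) ^ t : ℝ≥0) : ℝ≥0∞) ∂ν) :
    ENNReal.log lam ≤ pressure ν t := by
  have hmeas : ∀ v, Measurable fun M : Mat => ((F (planeMap M v) ^ t : ℝ≥0) : ℝ≥0∞) := fun v =>
    (((hF.measurable.comp (measurable_planeMap_apply v)).pow_const t)).coe_nnreal_ennreal
  -- The new factor is split off on the right, next to `v`: the one-step inequality is used at `v`,
  -- the induction hypothesis at `A v`.
  have hiter : ∀ (n : ℕ) v, lam ^ n * (F v ^ t : ℝ≥0) ≤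
      ∫⁻ M, ((F (planeMap M v) ^ t : ℝ≥0) : ℝ≥0∞) ∂(productLaw ν n) := by
    intro n
    induction n with
    | zero =>
      intro v
      rw [productLaw_zero, lintegral_dirac' _ (hmeas v), planeMap_one_apply]
      simp
    | succ n ih =>
      intro v
      rw [lintegral_productLaw_succ' _ _ (hmeas v), pow_succ, mul_assoc]
      calc _ ≤ lam ^ n * ∫⁻ A, ((F (planeMap A v) ^ t : ℝ≥0) : ℝ≥0∞) ∂ν := by gcongr; exact h v
        _ = ∫⁻ A, lam ^ n * ((F (planeMap A v) ^ t : ℝ≥0) : ℝ≥0∞) ∂ν :=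
          (lintegral_const_mul _ (hmeas v)).symm
        _ ≤ _ := lintegral_mono fun A => by
          simp only [planeMap_mul_apply]
          exact ih _
  obtain ⟨C, hC⟩ := exists_le_mul_nnnorm hF hhom
  obtain ⟨v, hv⟩ := hne
  refine log_le_pressure hν ht0 (c := (F v ^ t : ℝ≥0)) (K := ((C * ‖v‖₊) ^ t : ℝ≥0)) ?_
    ENNReal.coe_ne_top fun n => (hiter n v).trans ?_
  · simpa [NNReal.rpow_eq_zero_iff] using fun h => absurd h hv
  · rw [singValIntegral_eq_of_le_one _ ht0 ht1, ← lintegral_const_mul]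
    · refine lintegral_mono fun M => ?_
      rw [← ENNReal.coe_mul, ENNReal.coe_le_coe, ← NNReal.mul_rpow]
      refine NNReal.rpow_le_rpow ((hC _).trans ?_) ht0.le
      rw [mul_assoc, mul_comm ‖v‖₊]
      gcongr
      exact (planeMap M).le_opNNNorm v
    · exact ((continuous_planeMap.nnnorm.measurable).pow_const t).coe_nnreal_ennreal

end Growth

/-! ### Moments of random products and their generating series -/

noncomputable section Moments

/-- The integral of `‖M v‖ ^ t` against the law of the `n`-fold product. -/
def moment (ν : Measure Mat) (t : ℝ) (n : ℕ) (v : Plane) : ℝ≥0∞ :=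
  ∫⁻ M, ((‖planeMap M v‖₊ ^ t : ℝ≥0) : ℝ≥0∞) ∂(productLaw ν n)

/-- The partial sums of the generating series of the moments. -/
def momentSum (ν : Measure Mat) (t : ℝ) (lam : ℝ≥0∞) (n : ℕ) (v : Plane) : ℝ≥0∞ :=
  ∑ i ∈ Finset.range n, lam⁻¹ ^ i * moment ν t i v

/-- The generating series of the moments. -/
def momentSeries (ν : Measure Mat) (t : ℝ) (lam : ℝ≥0∞) (v : Plane) : ℝ≥0∞ :=
  ∑' i, lam⁻¹ ^ i * moment ν t i v

theorem measurable_nnnorm_rpow (t : ℝ) :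
    Measurable fun p : Plane × Mat => ((‖planeMap p.2 p.1‖₊ ^ t : ℝ≥0) : ℝ≥0∞) := by
  have h : Continuous fun p : Plane × Mat => planeMap p.2 p.1 :=
    (continuous_planeMap.comp continuous_snd).clm_apply continuous_fst
  exact (h.measurable.nnnorm.pow_const t).coe_nnreal_ennreal

theorem measurable_nnnorm_rpow_apply (t : ℝ) (v : Plane) :
    Measurable fun M : Mat => ((‖planeMap M v‖₊ ^ t : ℝ≥0) : ℝ≥0∞) :=
  ((measurable_planeMap_apply v).nnnorm.pow_const t).coe_nnreal_ennreal

variable {ν : Measure Mat} {t : ℝ} {lam : ℝ≥0∞}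

theorem moment_smul (n : ℕ) (a : ℝ) (v : Plane) :
    moment ν t n (a • v) = (‖a‖₊ ^ t : ℝ≥0) * moment ν t n v := by
  rw [moment, moment, ← lintegral_const_mul _ (measurable_nnnorm_rpow_apply t v)]
  refine lintegral_congr fun M => ?_
  rw [map_smul, nnnorm_smul, NNReal.mul_rpow, ENNReal.coe_mul]

/-- Subadditivity of `x ^ t` for `t ≤ 1`. It makes the convergence set of the series a linear
subspace. -/
theorem moment_add_le (ht : 0 < t) (ht1 : t ≤ 1) (n : ℕ) (v w : Plane) :
    moment ν t n (v + w) ≤ moment ν t n v + moment ν t n w := by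
  rw [moment, moment, moment, ← lintegral_add_left (measurable_nnnorm_rpow_apply t v)]
  refine lintegral_mono fun M => ?_
  rw [← ENNReal.coe_add, ENNReal.coe_le_coe, map_add]
  exact (NNReal.rpow_le_rpow (nnnorm_add_le _ _) ht.le).trans
    (NNReal.rpow_add_le_add_rpow _ _ ht.le ht1)

theorem momentSum_le_momentSeries (n : ℕ) (v : Plane) :
    momentSum ν t lam n v ≤ momentSeries ν t lam v :=
  ENNReal.sum_le_tsum _

theorem momentSum_smul (n : ℕ) (a : ℝ) (v : Plane) :
    momentSum ν t lam n (a • v) = (‖a‖₊ ^ t : ℝ≥0) * momentSum ν t lam n v := by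
  simp only [momentSum, Finset.mul_sum, moment_smul]
  exact Finset.sum_congr rfl fun i _ => by ring

theorem momentSum_add_le (ht : 0 < t) (ht1 : t ≤ 1) (n : ℕ) (v w : Plane) :
    momentSum ν t lam n (v + w) ≤ momentSum ν t lam n v + momentSum ν t lam n w := by
  simp only [momentSum, ← Finset.sum_add_distrib, ← mul_add]
  exact Finset.sum_le_sum fun i _ => by gcongr; exact moment_add_le ht ht1 i v w

theorem momentSeries_smul (a : ℝ) (v : Plane) :
    momentSeries ν t lam (a • v) = (‖a‖₊ ^ t : ℝ≥0) * momentSeries ν t lam v := by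
  simp only [momentSeries, ← ENNReal.tsum_mul_left, moment_smul]
  exact tsum_congr fun i => by ring

theorem momentSeries_add_le (ht : 0 < t) (ht1 : t ≤ 1) (v w : Plane) :
    momentSeries ν t lam (v + w) ≤ momentSeries ν t lam v + momentSeries ν t lam w := by
  simp only [momentSeries, ← ENNReal.tsum_add, ← mul_add]
  exact ENNReal.tsum_le_tsum fun i => by gcongr; exact moment_add_le ht ht1 i v w

variable [IsFiniteMeasure ν]

theorem moment_zero (v : Plane) : moment ν t 0 v = (‖v‖₊ ^ t : ℝ≥0) := by
  rw [moment, productLaw_zero, lintegral_dirac' _ (measurable_nnnorm_rpow_apply t v),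
    planeMap_one_apply]

theorem moment_succ (n : ℕ) (v : Plane) :
    moment ν t (n + 1) v = ∫⁻ A, moment ν t n (planeMap A v) ∂ν := by
  rw [moment, lintegral_productLaw_succ' _ _ (measurable_nnnorm_rpow_apply t v)]
  simp only [planeMap_mul_apply]; rfl

theorem moment_lt_top (hν : ∀ᵐ A ∂ν, ‖planeMap A‖ ≤ 1) (ht : 0 < t) (n : ℕ) (v : Plane) :
    moment ν t n v < ⊤ := by
  refine lt_of_le_of_lt (lintegral_mono_ae (g := fun _ => ((‖v‖₊ ^ t : ℝ≥0) : ℝ≥0∞)) ?_) ?_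
  · filter_upwards [ae_productLaw hν n] with M hM
    exact ENNReal.coe_le_coe.2 (NNReal.rpow_le_rpow (nnnorm_planeMap_apply_le hM v) ht.le)
  · rw [lintegral_const]
    exact ENNReal.mul_lt_top ENNReal.coe_lt_top (measure_lt_top _ _)

theorem continuous_moment (hν : ∀ᵐ A ∂ν, ‖planeMap A‖ ≤ 1) (ht : 0 < t) (n : ℕ) :
    Continuous (moment ν t n) := by
  refine continuous_iff_continuousAt.2 fun v => ?_
  refine tendsto_lintegral_filter_of_dominated_convergence
    (fun _ => (((‖v‖₊ + 1) ^ t : ℝ≥0) : ℝ≥0∞))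
    (.of_forall fun w => measurable_nnnorm_rpow_apply t w) ?_ ?_ ?_
  · filter_upwards [continuous_nnnorm.continuousAt.eventually_lt
      (continuousAt_const (y := ‖v‖₊ + 1)) (lt_add_one _)] with w hw
    filter_upwards [ae_productLaw hν n] with M hM
    exact ENNReal.coe_le_coe.2 (NNReal.rpow_le_rpow
      ((nnnorm_planeMap_apply_le hM w).trans hw.le) ht.le)
  · rw [lintegral_const]
    exact (ENNReal.mul_lt_top ENNReal.coe_lt_top (measure_lt_top _ _)).ne
  · refine .of_forall fun M => ?_
    refine (ENNReal.continuous_coe.comp ?_).tendsto v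
    exact (NNReal.continuous_rpow_const ht.le).comp (planeMap M).continuous.nnnorm

theorem measurable_moment (n : ℕ) : Measurable (moment ν t n) := by
  have h := (measurable_nnnorm_rpow t).lintegral_prod_right' (ν := productLaw ν n)
  unfold moment
  simpa only using h

theorem measurable_momentSeries : Measurable (momentSeries ν t lam) :=
  Measurable.tsum fun i => (measurable_moment i).const_mul _

theorem momentSum_lt_top (hν : ∀ᵐ A ∂ν, ‖planeMap A‖ ≤ 1) (ht : 0 < t) (h0 : lam ≠ 0) (n : ℕ)
    (v : Plane) : momentSum ν t lam n v < ⊤ :=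
  ENNReal.sum_lt_top.2 fun i _ => ENNReal.mul_lt_top
    (ENNReal.pow_lt_top (ENNReal.inv_lt_top.2 (pos_iff_ne_zero.2 h0))) (moment_lt_top hν ht i v)

theorem continuous_momentSum (hν : ∀ᵐ A ∂ν, ‖planeMap A‖ ≤ 1) (ht : 0 < t) (h0 : lam ≠ 0)
    (n : ℕ) : Continuous (momentSum ν t lam n) :=
  continuous_finsetSum _ fun i _ => (ENNReal.continuous_const_mul
    (ENNReal.pow_ne_top (ENNReal.inv_ne_top.2 h0))).comp (continuous_moment hν ht i)

/-- Integrating the partial sum along one step shifts the index. Partial sums are thus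
supersolutions up to the error `lam * ‖v‖ ^ t` from the zeroth term. -/
theorem mul_momentSum_le (h0 : lam ≠ 0) (htop : lam ≠ ⊤) (n : ℕ) (v : Plane) :
    lam * momentSum ν t lam n v ≤
      lam * (‖v‖₊ ^ t : ℝ≥0) + ∫⁻ A, momentSum ν t lam n (planeMap A v) ∂ν := by
  have h1 : momentSum ν t lam n v ≤ momentSum ν t lam (n + 1) v :=
    Finset.sum_le_sum_of_subset (Finset.range_mono n.le_succ)
  refine (mul_le_mul_right h1 lam).trans_eq ?_
  have hm : ∀ i, Measurable fun A : Mat => moment ν t i (planeMap A v) := fun i =>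
    (measurable_moment i).comp (measurable_planeMap_apply v)
  simp only [momentSum]
  rw [lintegral_finsetSum _ fun i _ => (hm i).const_mul _, Finset.sum_range_succ', mul_add,
    add_comm, pow_zero, one_mul, moment_zero, Finset.mul_sum]
  congr 1
  refine Finset.sum_congr rfl fun i _ => ?_
  rw [lintegral_const_mul _ (hm i), ← moment_succ, pow_succ, ← mul_assoc, mul_comm lam,
    mul_assoc (lam⁻¹ ^ i), ENNReal.inv_mul_cancel h0 htop, mul_one]

theorem lintegral_momentSeries_le (h0 : lam ≠ 0) (htop : lam ≠ ⊤) (v : Plane) :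
    ∫⁻ A, momentSeries ν t lam (planeMap A v) ∂ν ≤ lam * momentSeries ν t lam v := by
  have hm : ∀ i, Measurable fun A : Mat => moment ν t i (planeMap A v) := fun i =>
    (measurable_moment i).comp (measurable_planeMap_apply v)
  simp only [momentSeries]
  rw [lintegral_tsum fun i => ((hm i).const_mul _).aemeasurable,
    tsum_eq_zero_add' (f := fun i => lam⁻¹ ^ i * moment ν t i v) ENNReal.summable, mul_add]
  refine le_add_left ?_
  rw [← ENNReal.tsum_mul_left]
  refine ENNReal.tsum_le_tsum fun i => ?_
  rw [lintegral_const_mul _ (hm i), ← moment_succ, pow_succ, ← mul_assoc, mul_comm lam,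
    mul_assoc (lam⁻¹ ^ i), ENNReal.inv_mul_cancel h0 htop, mul_one]

/-- The vectors at which the generating series of the moments converges. -/
def finiteMoments (ν : Measure Mat) [IsFiniteMeasure ν] (t : ℝ) (lam : ℝ≥0∞) (ht : 0 < t)
    (ht1 : t ≤ 1) : Submodule ℝ Plane where
  carrier := {v | momentSeries ν t lam v < ⊤}
  add_mem' {v w} hv hw := (momentSeries_add_le ht ht1 v w).trans_lt (ENNReal.add_lt_top.2 ⟨hv, hw⟩)
  zero_mem' := by
    have h := momentSeries_smul (ν := ν) (t := t) (lam := lam) 0 (0 : Plane)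
    rw [zero_smul, nnnorm_zero, NNReal.zero_rpow ht.ne', ENNReal.coe_zero, zero_mul] at h
    change momentSeries ν t lam 0 < ⊤
    rw [h]
    exact ENNReal.zero_lt_top
  smul_mem' a v hv := by
    change momentSeries ν t lam (a • v) < ⊤
    rw [momentSeries_smul]
    exact ENNReal.mul_lt_top ENNReal.coe_lt_top hv

theorem ae_map_mem_finiteMoments (h0 : lam ≠ 0) (htop : lam ≠ ⊤) {ht : 0 < t} {ht1 : t ≤ 1}
    {v : Plane} (hv : v ∈ finiteMoments ν t lam ht ht1) :
    ∀ᵐ A ∂ν, planeMap A v ∈ finiteMoments ν t lam ht ht1 :=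
  ae_lt_top (measurable_momentSeries.comp (measurable_planeMap_apply v))
    ((lintegral_momentSeries_le h0 htop v).trans_lt (ENNReal.mul_lt_top htop.lt_top hv)).ne

/-- The norm of `M` is at most the sum of its norms on a basis. Since ∫ ‖M‖^t grows at least like
`lam ^ n`, the added terms of the two series never fall below 1 for positive indices, so both cannot
converge. -/
theorem not_forall_basis_mem_finiteMoments (hν : ∀ᵐ A ∂ν, ‖planeMap A‖ ≤ 1) (h0 : lam ≠ 0) (htop : lam ≠ ⊤)
    (ht : 0 < t) (ht1 : t ≤ 1) (hlam : ENNReal.log lam ≤ pressure ν t)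
    (b : OrthonormalBasis (Fin 2) ℝ Plane) (hb : ∀ i, b i ∈ finiteMoments ν t lam ht ht1) :
    False := by
  have hnorm : ∀ M : Mat, ‖planeMap M‖₊ ≤ ‖planeMap M (b 0)‖₊ + ‖planeMap M (b 1)‖₊ := fun M => by
    refine ContinuousLinearMap.opNNNorm_le_bound _ _ fun v => ?_
    have hi : ∀ i, ‖(inner ℝ (b i) v : ℝ)‖₊ ≤ ‖v‖₊ := fun i => by
      have := nnnorm_inner_le_nnnorm (𝕜 := ℝ) (b i) v
      rwa [show ‖b i‖₊ = 1 from NNReal.eq (b.orthonormal.1 i), one_mul] at this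
    conv_lhs => rw [← b.sum_repr' v, Fin.sum_univ_two, map_add, map_smul, map_smul]
    refine (nnnorm_add_le _ _).trans ?_
    rw [nnnorm_smul, nnnorm_smul, add_mul, mul_comm _ ‖v‖₊, mul_comm _ ‖v‖₊]
    gcongr <;> exact hi _
  have hle : ∀ n, 1 ≤ lam⁻¹ ^ (n + 1) * moment ν t (n + 1) (b 0) +
      lam⁻¹ ^ (n + 1) * moment ν t (n + 1) (b 1) := fun n => by
    have h1 := pow_le_singValIntegral hν ht hlam n
    have h2 : singValIntegral ν t (n + 1) ≤
        moment ν t (n + 1) (b 0) + moment ν t (n + 1) (b 1) := by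
      rw [singValIntegral_eq_of_le_one _ ht ht1, moment, moment,
        ← lintegral_add_left (measurable_nnnorm_rpow_apply t _)]
      refine lintegral_mono fun M => ?_
      rw [← ENNReal.coe_add, ENNReal.coe_le_coe]
      exact (NNReal.rpow_le_rpow (hnorm M) ht.le).trans
        (NNReal.rpow_add_le_add_rpow _ _ ht.le ht1)
    rw [← mul_add, ← ENNReal.inv_mul_cancel (pow_ne_zero (n + 1) h0) (ENNReal.pow_ne_top htop),
      ENNReal.inv_pow]
    gcongr
    exact h1.trans h2
  have hsum : (⊤ : ℝ≥0∞) ≤ momentSeries ν t lam (b 0) + momentSeries ν t lam (b 1) := by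
    rw [momentSeries, momentSeries, ← ENNReal.tsum_add, tsum_eq_zero_add' ENNReal.summable]
    refine le_add_left ?_
    rw [← ENNReal.tsum_const_eq_top_of_ne_zero (α := ℕ) one_ne_zero]
    exact ENNReal.tsum_le_tsum hle
  exact (hsum.trans_lt (ENNReal.add_lt_top.2 ⟨hb 0, hb 1⟩)).ne rfl

end Moments

/-! ### Test functions and robust lower bounds for the pressure -/

noncomputable section TestFunctions

/-- Turns a linear inequality into one between positive parts; the summand `q - p` is the correction
`N` of a test pair. -/
theorem NNReal.tsub_lt_tsub_add_tsub {p q r w : ℝ≥0} (h : p + r < w + q) :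
    p - q < w - r + (q - p) := by
  rcases le_or_gt q p with hqp | hqp
  · obtain ⟨k, rfl⟩ := exists_add_of_le hqp
    rw [tsub_eq_zero_of_le hqp, add_zero, add_tsub_cancel_left, lt_tsub_iff_right]
    rw [add_comm w, add_assoc] at h
    exact lt_of_add_lt_add_left h
  · rw [tsub_eq_zero_of_le hqp.le]
    exact add_pos_of_nonneg_of_pos zero_le (tsub_pos_of_lt hqp)

/-- A homogeneous function `F` with the robust (strict) form, up to a correction `N` supported on
the zero set of `F`, of the inequality `lam * F v ^ t ≤ ∫ F (A v) ^ t dν(A)`. -/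
structure IsTestPair (ν : Measure Mat) (t : ℝ) (lam : ℝ≥0) (F N : Plane → ℝ≥0) : Prop where
  continuous_fun : Continuous F
  continuous_correction : Continuous N
  homogeneous : ∀ (a : ℝ) v, F (a • v) = ‖a‖₊ * F v
  ne_zero : ∃ v, F v ≠ 0
  correction_eq_zero : ∀ v, F v ≠ 0 → N v = 0
  lt_lintegral : ∀ v, ‖v‖ = 1 → ((lam * F v ^ t : ℝ≥0) : ℝ≥0∞) <
    ∫⁻ A, ((F (planeMap A v) ^ t : ℝ≥0) : ℝ≥0∞) ∂ν + N v

variable {ν : Measure Mat} [IsFiniteMeasure ν] {t : ℝ} {lam : ℝ≥0}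

/-- By compactness of the circle one partial sum is large on all of it. Lowering `lam` to `lam'`
then absorbs the error term of `mul_momentSum_le`, and no correction is needed. -/
theorem exists_isTestPair_of_momentSeries_eq_top (hν : ∀ᵐ A ∂ν, ‖planeMap A‖ ≤ 1) (ht : 0 < t)
    (h : ∀ v ≠ 0, momentSeries ν t lam v = ⊤) {lam' : ℝ≥0} (hlt : lam' < lam) :
    ∃ F N, IsTestPair ν t lam' F N := by
  have h0 : (lam : ℝ≥0∞) ≠ 0 := by exact_mod_cast (bot_le.trans_lt hlt).ne'
  have hltE : (lam' : ℝ≥0∞) < lam := by exact_mod_cast hlt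
  have hsub0 : (lam - lam' : ℝ≥0∞) ≠ 0 := (tsub_pos_of_lt hltE).ne'
  have hsubt : (lam - lam' : ℝ≥0∞) ≠ ⊤ := (tsub_le_self.trans_lt ENNReal.coe_lt_top).ne
  have hcont := continuous_momentSum (lam := lam) hν ht h0
  -- The threshold is the one at which `(lam - lam') * S` exceeds the error `lam`.
  obtain ⟨n, hn⟩ : ∃ n, Metric.sphere (0 : Plane) 1 ⊆
      {v | (lam / (lam - lam') : ℝ≥0∞) < momentSum ν t lam n v} := by
    refine (isCompact_sphere _ _).elim_directed_cover _
      (fun n => isOpen_lt continuous_const (hcont n)) ?_ ?_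
    · intro v hv
      have hv0 : v ≠ 0 := by rintro rfl; simp at hv
      have htop := h v hv0
      rw [momentSeries, ENNReal.tsum_eq_iSup_nat, iSup_eq_top] at htop
      obtain ⟨n, hn⟩ := htop _ (ENNReal.div_lt_top ENNReal.coe_ne_top hsub0)
      exact Set.mem_iUnion.2 ⟨n, hn⟩
    · have hmono : Monotone fun n => {v | (lam / (lam - lam') : ℝ≥0∞) < momentSum ν t lam n v} :=
        fun i j hij v hv => lt_of_lt_of_le (b := momentSum ν t lam i v) hv
          (Finset.sum_le_sum_of_subset (Finset.range_mono hij))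
      exact hmono.directed_le
  set S := fun v => (momentSum ν t lam n v).toNNReal with hS
  have hSc : ∀ v, (S v : ℝ≥0∞) = momentSum ν t lam n v := fun v =>
    ENNReal.coe_toNNReal (momentSum_lt_top hν ht h0 n v).ne
  have hF : ∀ v, (S v ^ t⁻¹) ^ t = S v := fun v => NNReal.rpow_inv_rpow ht.ne' _
  have hstrict : ∀ v, ‖v‖ = 1 → (lam / (lam - lam') : ℝ≥0∞) < S v := fun v hv => by
    rw [hSc]; exact hn (by simpa using hv)
  refine ⟨fun v => S v ^ t⁻¹, fun _ => 0, ?_, continuous_const, ?_, ?_, fun _ _ => rfl, ?_⟩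
  · refine (NNReal.continuous_rpow_const (inv_nonneg.2 ht.le)).comp ?_
    exact ENNReal.continuousOn_toNNReal.comp_continuous (hcont n)
      fun v => (momentSum_lt_top hν ht h0 n v).ne
  · intro a v
    simp only [hS, momentSum_smul, ENNReal.toNNReal_mul, ENNReal.toNNReal_coe, NNReal.mul_rpow]
    rw [NNReal.rpow_rpow_inv ht.ne']
  · have hv : ‖(EuclideanSpace.single 0 1 : Plane)‖ = 1 := by simp
    refine ⟨EuclideanSpace.single 0 1, fun h => ?_⟩
    have h1 := hstrict _ hv
    rw [← hF, h, NNReal.zero_rpow ht.ne'] at h1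
    exact not_lt_bot h1
  · intro v hv
    simp only [hF, ENNReal.coe_zero, add_zero, hSc]
    have h1 := mul_momentSum_le (ν := ν) (t := t) h0 ENNReal.coe_ne_top n v
    have hv1 : ‖v‖₊ = 1 := NNReal.eq hv
    rw [hv1, NNReal.one_rpow, ENNReal.coe_one, mul_one] at h1
    have h2 := hstrict v hv
    rw [hSc, ENNReal.div_lt_iff (Or.inl hsub0) (Or.inl hsubt), ENNReal.mul_sub (fun _ _ =>
      (momentSum_lt_top hν ht h0 n v).ne), lt_tsub_iff_right] at h2
    rw [ENNReal.coe_mul, hSc]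
    by_contra! h3
    refine absurd (h1.trans (add_le_add_right h3 _)) (not_le.2 ?_)
    rwa [mul_comm (lam' : ℝ≥0∞), mul_comm (lam : ℝ≥0∞) (momentSum _ _ _ _ _)]

/-- In the basis `b` almost every `A` is upper triangular. With α and β the integrals of the `t`-th
powers of the moduli of the diagonal entries, α < lam ≤ β: growth comes from the quotient direction,
so `F` is supported on a cone around it. -/
theorem exists_isTestPair_of_invariant_line (hν : ∀ᵐ A ∂ν, ‖planeMap A‖ ≤ 1) (ht : 0 < t)
    (ht1 : t ≤ 1) (b : OrthonormalBasis (Fin 2) ℝ Plane)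
    (hb0 : momentSeries ν t lam (b 0) < ⊤) (hb1 : momentSeries ν t lam (b 1) = ⊤)
    (hinv : ∀ᵐ A ∂ν, inner ℝ (b 1) (planeMap A (b 0)) = 0) {c : ℝ≥0} (hlt : c < lam) :
    ∃ lam' > c, ∃ F N, IsTestPair ν t lam' F N := by
  have h0' : lam ≠ 0 := (bot_le.trans_lt hlt).ne'
  have h0 : (lam : ℝ≥0∞) ≠ 0 := by exact_mod_cast h0'
  have hn : ∀ i, ‖b i‖₊ = 1 := fun i => NNReal.eq (b.orthonormal.1 i)
  set X : Plane → ℝ≥0 := fun v => ‖(inner ℝ (b 0) v : ℝ)‖₊ ^ t with hX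
  set Y : Plane → ℝ≥0 := fun v => ‖(inner ℝ (b 1) v : ℝ)‖₊ ^ t with hY
  have hXc : Continuous X := (NNReal.continuous_rpow_const ht.le).comp
    (continuous_const.inner continuous_id).nnnorm
  have hYc : Continuous Y := (NNReal.continuous_rpow_const ht.le).comp
    (continuous_const.inner continuous_id).nnnorm
  have hXm : ∀ v, Measurable fun A : Mat => (X (planeMap A v) : ℝ≥0∞) := fun v =>
    (hXc.measurable.comp (measurable_planeMap_apply v)).coe_nnreal_ennreal
  have hYm : ∀ v, Measurable fun A : Mat => (Y (planeMap A v) : ℝ≥0∞) := fun v =>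
    (hYc.measurable.comp (measurable_planeMap_apply v)).coe_nnreal_ennreal
  have hX1 : ∀ v, ‖v‖₊ ≤ 1 → X v ≤ 1 := fun v hv => by
    refine NNReal.rpow_le_one ?_ ht.le
    exact (nnnorm_inner_le_nnnorm _ _).trans (by rw [hn, one_mul]; exact hv)
  have hY1 : ∀ v, ‖v‖₊ ≤ 1 → Y v ≤ 1 := fun v hv => by
    refine NNReal.rpow_le_one ?_ ht.le
    exact (nnnorm_inner_le_nnnorm _ _).trans (by rw [hn, one_mul]; exact hv)
  have hsum : ∀ v, v = (inner ℝ (b 0) v : ℝ) • b 0 + (inner ℝ (b 1) v : ℝ) • b 1 := fun v => by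
    conv_lhs => rw [← b.sum_repr' v, Fin.sum_univ_two]
  have hA1 : ∀ A : Mat, ‖planeMap A‖ ≤ 1 → ∀ i, ‖planeMap A (b i)‖₊ ≤ 1 := fun A hA i =>
    (nnnorm_planeMap_apply_le hA _).trans_eq (hn i)
  have hXsmul : ∀ (a : ℝ) v, X (a • v) = ‖a‖₊ ^ t * X v := fun a v => by
    simp only [hX, inner_smul_right, nnnorm_mul, NNReal.mul_rpow]
  have hYsmul : ∀ (a : ℝ) v, Y (a • v) = ‖a‖₊ ^ t * Y v := fun a v => by
    simp only [hY, inner_smul_right, nnnorm_mul, NNReal.mul_rpow]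
  have hXA : ∀ A : Mat, ‖planeMap A‖ ≤ 1 → ∀ v,
      X (planeMap A v) ≤ X (planeMap A (b 0)) * X v + Y v := fun A hA v => by
    have h1 : X (planeMap A v) ≤ X ((inner ℝ (b 0) v : ℝ) • planeMap A (b 0)) +
        X ((inner ℝ (b 1) v : ℝ) • planeMap A (b 1)) := by
      conv_lhs => rw [hsum v, map_add, map_smul, map_smul]
      simp only [hX]
      rw [inner_add_right]
      exact (NNReal.rpow_le_rpow (nnnorm_add_le _ _) ht.le).trans
        (NNReal.rpow_add_le_add_rpow _ _ ht.le ht1)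
    refine h1.trans ?_
    rw [hXsmul, hXsmul, mul_comm]
    gcongr
    exact mul_le_of_le_one_right' (hX1 _ (hA1 A hA 1))
  have hYA : ∀ A : Mat, inner ℝ (b 1) (planeMap A (b 0)) = 0 → ∀ v,
      Y (planeMap A v) = Y (planeMap A (b 1)) * Y v := fun A hA v => by
    conv_lhs => rw [hsum v, map_add, map_smul, map_smul]
    simp only [hY]
    rw [inner_add_right, inner_smul_right, hA, mul_zero, zero_add, inner_smul_right, nnnorm_mul,
      NNReal.mul_rpow, mul_comm]
  have hfin : ∀ f : Mat → ℝ≥0, (∀ᵐ A ∂ν, f A ≤ 1) → ∫⁻ A, (f A : ℝ≥0∞) ∂ν ≠ ⊤ := fun f hf => by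
    refine (lt_of_le_of_lt (lintegral_mono_ae (g := fun _ => 1) ?_) ?_).ne
    · filter_upwards [hf] with A hA
      exact_mod_cast hA
    · simp
  obtain ⟨α, hα⟩ : ∃ α : ℝ≥0, (α : ℝ≥0∞) = ∫⁻ A, (X (planeMap A (b 0)) : ℝ≥0∞) ∂ν :=
    ⟨_, ENNReal.coe_toNNReal (hfin _ (hν.mono fun A hA => hX1 _ (hA1 A hA 0)))⟩
  obtain ⟨β, hβ⟩ : ∃ β : ℝ≥0, (β : ℝ≥0∞) = ∫⁻ A, (Y (planeMap A (b 1)) : ℝ≥0∞) ∂ν :=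
    ⟨_, ENNReal.coe_toNNReal (hfin _ (hν.mono fun A hA => hY1 _ (hA1 A hA 1)))⟩
  obtain ⟨m, hm⟩ : ∃ m : ℝ≥0, (m : ℝ≥0∞) = ν Set.univ :=
    ⟨_, ENNReal.coe_toNNReal (measure_ne_top ν _)⟩
  -- On the invariant line the moments are exactly the powers of α, so convergence is that of a
  -- geometric series.
  have hαlt : α < lam := by
    by_contra! hle
    have hmom : ∀ n, moment ν t n (b 0) = (α : ℝ≥0∞) ^ n := by
      intro n
      induction n with
      | zero => rw [moment_zero, hn]; simp
      | succ n ih =>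
        rw [moment_succ, pow_succ', hα, ← lintegral_mul_const _ (hXm _)]
        refine lintegral_congr_ae ?_
        filter_upwards [hinv] with A hA
        conv_lhs => rw [hsum (planeMap A (b 0)), hA, zero_smul, add_zero, moment_smul, ih]
        rw [hα]
    refine hb0.ne (top_le_iff.1 ?_)
    rw [← ENNReal.tsum_const_eq_top_of_ne_zero (α := ℕ) one_ne_zero]
    refine ENNReal.tsum_le_tsum fun n => ?_
    rw [hmom, ← mul_pow]
    refine one_le_pow₀ ?_
    rw [← ENNReal.inv_mul_cancel h0 ENNReal.coe_ne_top]
    gcongr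
  -- If β < lam, the one-step inequality at `b 1` can be solved for the partial sum, bounding it
  -- independently of `n`.
  have hβle : lam ≤ β := by
    by_contra! hlt'
    have hltE : (β : ℝ≥0∞) < lam := by exact_mod_cast hlt'
    have hsub0 : (lam - β : ℝ≥0∞) ≠ 0 := (tsub_pos_of_lt hltE).ne'
    have hsubt : (lam - β : ℝ≥0∞) ≠ ⊤ := (tsub_le_self.trans_lt ENNReal.coe_lt_top).ne
    have hS : ∀ n, momentSum ν t lam n (b 1) ≤
        (lam + m * momentSeries ν t lam (b 0)) / (lam - β) := fun n => by
      have h1 := mul_momentSum_le (ν := ν) (t := t) h0 ENNReal.coe_ne_top n (b 1)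
      rw [hn, NNReal.one_rpow, ENNReal.coe_one, mul_one] at h1
      have h2 : ∫⁻ A, momentSum ν t lam n (planeMap A (b 1)) ∂ν ≤
          m * momentSeries ν t lam (b 0) + β * momentSum ν t lam n (b 1) := by
        calc _ ≤ ∫⁻ A, (momentSeries ν t lam (b 0) +
              Y (planeMap A (b 1)) * momentSum ν t lam n (b 1)) ∂ν := by
              refine lintegral_mono_ae ?_
              filter_upwards [hν] with A hA
              conv_lhs => rw [hsum (planeMap A (b 1))]
              refine (momentSum_add_le ht ht1 n _ _).trans ?_
              rw [momentSum_smul, momentSum_smul]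
              gcongr
              refine le_trans ?_ (momentSum_le_momentSeries n (b 0))
              exact mul_le_of_le_one_left' (by exact_mod_cast hX1 _ (hA1 A hA 1))
          _ = _ := by
              rw [lintegral_add_left measurable_const, lintegral_const,
                lintegral_mul_const _ (hYm _), hβ, hm, mul_comm]
      have hfS := (momentSum_lt_top hν ht h0 n (b 1)).ne
      rw [ENNReal.le_div_iff_mul_le (Or.inl hsub0) (Or.inl hsubt), ENNReal.mul_sub fun _ _ => hfS,
        tsub_le_iff_right, mul_comm, mul_comm _ (β : ℝ≥0∞), add_assoc]
      exact h1.trans (add_le_add_right h2 _)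
    refine (ENNReal.div_lt_top (ENNReal.add_lt_top.2 ⟨ENNReal.coe_lt_top (r := lam),
      ENNReal.mul_lt_top (ENNReal.coe_lt_top (r := m)) hb0⟩).ne hsub0).ne (top_le_iff.1 ?_)
    rw [← hb1, momentSeries, ENNReal.tsum_eq_iSup_nat]
    exact iSup_le hS
  obtain ⟨lam', hl1, hl2⟩ := exists_between (max_lt hαlt hlt)
  obtain ⟨hl3, hl4⟩ := max_lt_iff.1 hl1
  -- The off-diagonal entry contributes at most the total mass `m`; a small δ keeps this loss below
  -- the gap `β - lam'`.
  obtain ⟨δ, hδ0, hδ⟩ : ∃ δ : ℝ≥0, 0 < δ ∧ lam' + δ * m < β := by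
    have hpos : 0 < β - lam' := tsub_pos_of_lt (hl2.trans_le hβle)
    refine ⟨(β - lam') / (m + 1), by positivity, ?_⟩
    rw [← lt_tsub_iff_left, div_mul_eq_mul_div, div_lt_iff₀ (by positivity)]
    exact mul_lt_mul_of_pos_left (lt_add_one m) hpos
  refine ⟨lam', hl4, fun v => (Y v - δ * X v) ^ t⁻¹, fun v => lam' * (δ * X v - Y v),
    ?_, ?_, ?_, ?_, ?_, ?_⟩
  · exact (NNReal.continuous_rpow_const (inv_nonneg.2 ht.le)).comp
      (hYc.sub (continuous_const.mul hXc))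
  · exact continuous_const.mul ((continuous_const.mul hXc).sub hYc)
  · intro a v
    rw [hXsmul, hYsmul, mul_left_comm, ← mul_tsub, NNReal.mul_rpow, NNReal.rpow_rpow_inv ht.ne']
  · refine ⟨b 1, ?_⟩
    have h1 : X (b 1) = 0 := by
      simp only [hX, b.orthonormal.2 (zero_ne_one), nnnorm_zero, NNReal.zero_rpow ht.ne']
    have h2 : Y (b 1) = 1 := by
      simp only [hY, real_inner_self_eq_norm_sq, b.orthonormal.1]; simp
    simp [h1, h2]
  · intro v hv
    have h1 : Y v - δ * X v ≠ 0 := fun h => hv (by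
      simp only [h]; exact NNReal.zero_rpow (inv_ne_zero ht.ne'))
    have h2 : δ * X v < Y v := by
      by_contra! h3
      exact h1 (tsub_eq_zero_of_le h3)
    simp only [tsub_eq_zero_of_le h2.le, mul_zero]
  · intro v hv
    simp only [NNReal.rpow_inv_rpow ht.ne']
    have hint : ((β * Y v - δ * (α * X v + m * Y v) : ℝ≥0) : ℝ≥0∞) ≤
        ∫⁻ A, ((Y (planeMap A v) - δ * X (planeMap A v) : ℝ≥0) : ℝ≥0∞) ∂ν := by
      simp only [ENNReal.coe_sub]
      refine le_trans ?_ (lintegral_sub_le _ _ ?_)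
      · refine tsub_le_tsub (le_of_eq ?_) ?_
        · rw [ENNReal.coe_mul, hβ, ← lintegral_mul_const _ (hYm _)]
          refine lintegral_congr_ae ?_
          filter_upwards [hinv] with A hA
          rw [hYA A hA v, ENNReal.coe_mul]
        · simp only [ENNReal.coe_mul]
          rw [lintegral_const_mul _ (hXm _)]
          gcongr
          calc ∫⁻ A, (X (planeMap A v) : ℝ≥0∞) ∂ν
              ≤ ∫⁻ A, ((X (planeMap A (b 0)) : ℝ≥0∞) * X v + Y v) ∂ν := by
                refine lintegral_mono_ae ?_
                filter_upwards [hν] with A hA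
                exact_mod_cast hXA A hA v
            _ = _ := by
                rw [lintegral_add_right _ measurable_const, lintegral_const,
                  lintegral_mul_const _ (hXm _), ← hα, ← hm]
                push_cast
                ring
      · simp only [ENNReal.coe_mul]
        exact (hXm v).const_mul _
    have hXY : X v ≠ 0 ∨ Y v ≠ 0 := by
      by_contra! h
      have hz : ∀ i, (inner ℝ (b i) v : ℝ) = 0 := by
        intro i
        fin_cases i
        · exact nnnorm_eq_zero.1 ((NNReal.rpow_eq_zero ht.ne').1 h.1)
        · exact nnnorm_eq_zero.1 ((NNReal.rpow_eq_zero ht.ne').1 h.2)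
      rw [hsum v, hz, hz] at hv
      simp at hv
    -- Compare coefficients: `lam' + δ * m < β` on `Y` and `α < lam'` on `δ * X`; one of `X v`, `Y
    -- v` is nonzero, which gives strictness.
    have hkey : lam' * Y v + δ * (α * X v + m * Y v) < β * Y v + lam' * (δ * X v) := by
      have e1 : lam' * Y v + δ * (α * X v + m * Y v) =
          (lam' + δ * m) * Y v + α * (δ * X v) := by ring
      rw [e1]
      rcases hXY with h | h
      · refine add_lt_add_of_le_of_lt (mul_le_mul_left hδ.le _) ?_
        exact mul_lt_mul_of_pos_right hl3 (mul_pos hδ0 (pos_iff_ne_zero.2 h))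
      · refine add_lt_add_of_lt_of_le ?_ (mul_le_mul_left hl3.le _)
        exact mul_lt_mul_of_pos_right hδ (pos_iff_ne_zero.2 h)
    refine lt_of_lt_of_le ?_ (add_le_add_left hint _)
    rw [← ENNReal.coe_add, ENNReal.coe_lt_coe]
    rw [mul_tsub, mul_tsub]
    exact NNReal.tsub_lt_tsub_add_tsub hkey

/-- Every lower bound for the pressure is witnessed by a test pair. -/
theorem exists_isTestPair (hν : ∀ᵐ A ∂ν, ‖planeMap A‖ ≤ 1) (ht : 0 < t) (ht1 : t ≤ 1) {c : EReal}
    (hc : c < pressure ν t) :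
    ∃ lam : ℝ≥0, c < ENNReal.log lam ∧ ∃ F N, IsTestPair ν t lam F N := by
  obtain ⟨x, hcx, hx⟩ := exists_between hc
  obtain ⟨lamE, rfl⟩ := ENNReal.log_surjective x
  have htop : lamE ≠ ⊤ := by
    rintro rfl
    rw [ENNReal.log_top] at hx
    exact not_top_lt hx
  lift lamE to ℝ≥0 using htop with lam
  obtain ⟨cE, rfl⟩ := ENNReal.log_surjective c
  rw [ENNReal.log_lt_log_iff] at hcx
  lift cE to ℝ≥0 using hcx.ne_top with c
  have hlt : c < lam := by exact_mod_cast hcx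
  have h0 : (lam : ℝ≥0∞) ≠ 0 := by exact_mod_cast (bot_le.trans_lt hlt).ne'
  suffices h : ∃ lam' > c, ∃ F N, IsTestPair ν t lam' F N by
    obtain ⟨lam', h1, h2⟩ := h
    exact ⟨lam', by simpa using h1, h2⟩
  set V := finiteMoments ν t lam ht ht1 with hV
  by_cases hbot : ∀ v ≠ 0, momentSeries ν t lam v = ⊤
  · obtain ⟨lam', h1, h2⟩ := exists_between hlt
    exact ⟨lam', h1, exists_isTestPair_of_momentSeries_eq_top hν ht hbot h2⟩
  push Not at hbot
  obtain ⟨v, hv0, hv⟩ := hbot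
  have hvV : v ∈ V := lt_top_iff_ne_top.2 hv
  obtain ⟨b, hb⟩ := Orthonormal.exists_orthonormalBasis_extension_of_card_eq (𝕜 := ℝ) (E := Plane)
    (ι := Fin 2) (by simp) (v := fun _ => (‖v‖⁻¹ : ℝ) • v) (s := {0})
    ⟨fun i => by simp [Set.domRestrict, norm_smul, hv0], fun i j hij =>
      absurd (Subsingleton.elim i j) hij⟩
  have hb0 : b 0 ∈ V := by
    rw [hb 0 rfl]
    exact V.smul_mem _ hvV
  have hb1 : b 1 ∉ V := fun h => not_forall_basis_mem_finiteMoments hν h0 ENNReal.coe_ne_top ht ht1 hx.le b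
    (Fin.forall_fin_two.2 ⟨hb0, h⟩)
  refine exists_isTestPair_of_invariant_line hν ht ht1 b hb0
    (not_lt_top_iff.1 hb1) ?_ hlt
  -- A nonzero component of `A (b 0)` along `b 1` would put `b 1` into the invariant subspace.
  filter_upwards [ae_map_mem_finiteMoments h0 ENNReal.coe_ne_top hb0] with A hA
  by_contra hne
  have h1 := b.sum_repr' (planeMap A (b 0))
  rw [Fin.sum_univ_two] at h1
  have h2 : (inner ℝ (b 1) (planeMap A (b 0)) : ℝ) • b 1 ∈ V := by
    rw [← eq_sub_iff_add_eq'] at h1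
    rw [h1]
    exact V.sub_mem hA (V.smul_mem _ hb0)
  exact hb1 ((V.smul_mem_iff hne).1 h2)

/-- Lower semicontinuity of the pressure along a filter along which the transfer operators
converge locally uniformly. -/
theorem eventually_lt_pressure {ι : Type*} {l : Filter ι} {κ : ι → Measure Mat}
    [∀ i, IsFiniteMeasure (κ i)] (hκ : ∀ i, ∀ᵐ A ∂(κ i), ‖planeMap A‖ ≤ 1) {u : ι → ℝ}
    (hu : ∀ᶠ i in l, 0 < u i ∧ u i ≤ 1) (hν : ∀ᵐ A ∂ν, ‖planeMap A‖ ≤ 1) (ht : 0 < t) (ht1 : t ≤ 1)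
    (hut : Tendsto u l (𝓝 t))
    (H : ∀ F : Plane → ℝ≥0, Continuous F → ∀ v, Tendsto
      (fun p : ι × Plane => ∫⁻ A, ((F (planeMap A p.2) ^ u p.1 : ℝ≥0) : ℝ≥0∞) ∂(κ p.1))
      (l ×ˢ 𝓝 v) (𝓝 (∫⁻ A, ((F (planeMap A v) ^ t : ℝ≥0) : ℝ≥0∞) ∂ν)))
    {c : EReal} (hc : c < pressure ν t) : ∀ᶠ i in l, c < pressure (κ i) (u i) := by
  obtain ⟨lam, hlam, F, N, hFN⟩ := exists_isTestPair hν ht ht1 hc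
  have hloc : ∀ v ∈ Metric.sphere (0 : Plane) 1, ∀ᶠ p : ι × Plane in l ×ˢ 𝓝 v,
      ((lam * F p.2 ^ u p.1 : ℝ≥0) : ℝ≥0∞) <
        ∫⁻ A, ((F (planeMap A p.2) ^ u p.1 : ℝ≥0) : ℝ≥0∞) ∂(κ p.1) + N p.2 := by
    intro v hv
    refine Tendsto.eventually_lt (ENNReal.tendsto_coe.2 ?_) ((H F hFN.continuous_fun v).add
      (ENNReal.tendsto_coe.2 ((hFN.continuous_correction.tendsto v).comp tendsto_snd)))
      (hFN.lt_lintegral v (by simpa using hv))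
    exact ((NNReal.continuousAt_rpow (Or.inr ht)).tendsto.comp
      (((hFN.continuous_fun.tendsto v).comp tendsto_snd).prodMk_nhds
        (hut.comp tendsto_fst))).const_mul _
  -- The strict inequality is open near each `v`; compactness of the circle makes the range of `i`
  -- uniform.
  have hev : ∀ᶠ i in l, ∀ v ∈ Metric.sphere (0 : Plane) 1,
      ((lam * F v ^ u i : ℝ≥0) : ℝ≥0∞) <
        ∫⁻ A, ((F (planeMap A v) ^ u i : ℝ≥0) : ℝ≥0∞) ∂(κ i) + N v := by
    have h1 : ∀ᶠ p : ι × Plane in l ×ˢ 𝓝ˢ (Metric.sphere (0 : Plane) 1),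
        ((lam * F p.2 ^ u p.1 : ℝ≥0) : ℝ≥0∞) <
          ∫⁻ A, ((F (planeMap A p.2) ^ u p.1 : ℝ≥0) : ℝ≥0∞) ∂(κ p.1) + N p.2 := by
      rw [(isCompact_sphere (0 : Plane) 1).prod_nhdsSet_eq_biSup]
      simpa only [eventually_iSup] using hloc
    exact h1.curry.mono fun i h => h.self_of_nhdsSet
  filter_upwards [hev, hu] with i hi ⟨hu0, hu1⟩
  refine hlam.trans_le (log_le_pressure_of_superharmonic (hκ i) hu0 hu1 hFN.continuous_fun
    hFN.homogeneous hFN.ne_zero fun v => ?_)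
  -- Where `F` vanishes nothing is required, and elsewhere the correction `N` is zero; so `N` costs
  -- nothing in the conclusion.
  by_cases hFv : F v = 0
  · rw [hFv, NNReal.zero_rpow hu0.ne', ENNReal.coe_zero, mul_zero]
    exact zero_le
  have hv0 : v ≠ 0 := by
    rintro rfl
    have := hFN.homogeneous 0 0
    rw [zero_smul, nnnorm_zero, zero_mul] at this
    exact hFv this
  have hnv : ‖v‖ ≠ 0 := norm_ne_zero_iff.2 hv0
  set w : Plane := ‖v‖⁻¹ • v with hw
  have hvw : v = ‖v‖ • w := by rw [hw, smul_smul, mul_inv_cancel₀ hnv, one_smul]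
  have hFw : F w ≠ 0 := by
    rw [hw, hFN.homogeneous]
    exact mul_ne_zero (by simpa using hv0) hFv
  have h1 := (hi w (by simp [hw, norm_smul, hv0])).le
  rw [hFN.correction_eq_zero w hFw, ENNReal.coe_zero, add_zero, ENNReal.coe_mul] at h1
  have hhom : ∀ x, F (‖v‖ • x) ^ u i = ‖v‖₊ ^ u i * F x ^ u i := fun x => by
    rw [hFN.homogeneous, nnnorm_norm, NNReal.mul_rpow]
  rw [hvw]
  simp only [map_smul, hhom, ENNReal.coe_mul]
  have hmeas : Measurable fun A : Mat => ((F (planeMap A w) ^ u i : ℝ≥0) : ℝ≥0∞) :=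
    ((hFN.continuous_fun.measurable.comp
      (measurable_planeMap_apply w)).pow_const _).coe_nnreal_ennreal
  rw [lintegral_const_mul _ hmeas, mul_left_comm]
  gcongr

end TestFunctions

/-! ### Weighting measures by powers of the determinant -/

noncomputable section DetWeight

/-- The weight `|det A| ^ r`, vanishing at singular matrices. -/
def detWeight (r : ℝ) (A : Mat) : ℝ≥0∞ :=
  if A.det = 0 then 0 else ((‖A.det‖₊ ^ r : ℝ≥0) : ℝ≥0∞)

/-- The measure `|det A| ^ r dμ(A)`, carried by invertible matrices. -/
def detWeighted (μ : Measure Mat) (r : ℝ) : Measure Mat := μ.withDensity (detWeight r)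

theorem continuous_nnnorm_det : Continuous fun A : Mat => ‖A.det‖₊ :=
  (Continuous.matrix_det continuous_id).nnnorm

theorem measurable_detWeight (r : ℝ) : Measurable (detWeight r) :=
  Measurable.ite (continuous_id.matrix_det.measurable (measurableSet_singleton 0))
    measurable_const (continuous_nnnorm_det.measurable.pow_const r).coe_nnreal_ennreal

theorem detWeight_one (r : ℝ) : detWeight r 1 = 1 := by simp [detWeight]

theorem detWeight_mul (r : ℝ) (A B : Mat) :
    detWeight r (A * B) = detWeight r A * detWeight r B := by
  unfold detWeight
  by_cases hA : A.det = 0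
  · simp [hA]
  by_cases hB : B.det = 0
  · simp [hB]
  simp only [Matrix.det_mul, mul_eq_zero, hA, hB, or_self, if_false, nnnorm_mul, NNReal.mul_rpow,
    ENNReal.coe_mul]

theorem detWeight_of_pos {r : ℝ} (hr : 0 < r) (A : Mat) :
    detWeight r A = ((‖A.det‖₊ ^ r : ℝ≥0) : ℝ≥0∞) := by
  unfold detWeight
  split_ifs with h
  · simp [h, NNReal.zero_rpow hr.ne']
  · rfl

theorem detWeight_le {r : ℝ} (hr : 0 ≤ r) {A : Mat} (hA : ‖planeMap A‖ ≤ 1) :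
    detWeight r A ≤ detWeight 0 A := by
  unfold detWeight
  split_ifs with h
  · exact le_rfl
  · rw [NNReal.rpow_zero]
    exact ENNReal.coe_le_coe.2 (NNReal.rpow_le_one (abs_det_le_one hA) hr)

theorem detWeight_zero_le_one (A : Mat) : detWeight 0 A ≤ 1 := by
  unfold detWeight; split_ifs <;> simp

theorem detWeight_le_one {r : ℝ} (hr : 0 ≤ r) {A : Mat} (hA : ‖planeMap A‖ ≤ 1) :
    detWeight r A ≤ 1 :=
  (detWeight_le hr hA).trans (detWeight_zero_le_one A)

theorem detWeight_ne_top (r : ℝ) (A : Mat) : detWeight r A ≠ ⊤ := by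
  unfold detWeight; split_ifs <;> simp

/-- Continuity at `r = 0` relies on the value 0 at singular matrices, where the convention 0^0 = 1
would give a jump. This is how μ⁰ appears as the limit at exponent one. -/
theorem continuous_detWeight_exponent (A : Mat) : Continuous fun r => detWeight r A := by
  unfold detWeight
  split_ifs with h
  · exact continuous_const
  · refine ENNReal.continuous_coe.comp (continuous_iff_continuousAt.2 fun r => ?_)
    exact (NNReal.continuousAt_rpow (Or.inl (by simpa using h))).comp
      (f := fun r => (‖A.det‖₊, r)) (by fun_prop)

theorem isFiniteMeasure_withDensity_of_le_one {μ : Measure Mat} [IsFiniteMeasure μ]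
    {k : Mat → ℝ≥0∞} (hk : ∀ᵐ A ∂μ, k A ≤ 1) : IsFiniteMeasure (μ.withDensity k) :=
  isFiniteMeasure_withDensity (lt_of_le_of_lt (lintegral_mono_ae hk) (by simp)).ne

theorem ae_detWeighted {μ : Measure Mat} (hμ : ∀ᵐ A ∂μ, ‖planeMap A‖ ≤ 1) (r : ℝ) :
    ∀ᵐ A ∂(detWeighted μ r), ‖planeMap A‖ ≤ 1 :=
  (withDensity_absolutelyContinuous μ _).ae_le hμ

variable {μ : Measure Mat} [IsFiniteMeasure μ]

theorem isFiniteMeasure_detWeighted (hμ : ∀ᵐ A ∂μ, ‖planeMap A‖ ≤ 1) {r : ℝ} (hr : 0 ≤ r) :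
    IsFiniteMeasure (detWeighted μ r) :=
  isFiniteMeasure_withDensity_of_le_one (hμ.mono fun _ hA => detWeight_le_one hr hA)

theorem singValIntegral_detWeighted (hμ : ∀ᵐ A ∂μ, ‖planeMap A‖ ≤ 1) {r s : ℝ} (hr : 0 ≤ r)
    (hs : 0 < s) (n : ℕ) : singValIntegral (detWeighted μ r) s n =
      ∫⁻ M, detWeight r M * ENNReal.ofReal (singValFun s M) ∂(productLaw μ n) := by
  have : IsFiniteMeasure (μ.withDensity (detWeight r)) := isFiniteMeasure_detWeighted hμ hr
  exact lintegral_productLaw_withDensity μ (measurable_detWeight r) (detWeight_one r)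
    (detWeight_mul r) n (measurable_ofReal_singValFun hs)

theorem pressure_eq_pressure_detWeighted (hμ : ∀ᵐ A ∂μ, ‖planeMap A‖ ≤ 1) {s : ℝ} (h1 : 1 < s)
    (h2 : s < 2) : pressure μ s = pressure (detWeighted μ (s - 1)) (2 - s) := by
  have h : pressureSeq μ s = pressureSeq (detWeighted μ (s - 1)) (2 - s) := by
    funext n
    rw [pressureSeq_eq, pressureSeq_eq,
      singValIntegral_detWeighted hμ (by linarith) (by linarith) n]
    congr 2
    refine lintegral_congr fun M => ?_
    rw [singValFun_of_one_le h1.le h2, singValFun_of_le_one (by linarith) (by linarith), mul_comm,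
      ENNReal.ofReal_mul (by positivity), detWeight_of_pos (by linarith),
      ← ENNReal.ofReal_coe_nnreal, NNReal.coe_rpow, coe_nnnorm, Real.norm_eq_abs]
  rw [pressure, pressure, h]

theorem pressure_detWeighted_le (hμ : ∀ᵐ A ∂μ, ‖planeMap A‖ ≤ 1) {r s : ℝ} (hr : 0 ≤ r)
    (hs : 0 < s) : pressure (detWeighted μ r) s ≤ pressure (detWeighted μ 0) s := by
  have := isFiniteMeasure_detWeighted hμ hr
  have := isFiniteMeasure_detWeighted hμ le_rfl
  rw [pressure_eq_iInf (ae_detWeighted hμ _) hs, pressure_eq_iInf (ae_detWeighted hμ _) hs]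
  refine iInf_mono fun n => pressureSeq_mono_integral ?_
  rw [singValIntegral_detWeighted hμ hr hs, singValIntegral_detWeighted hμ le_rfl hs]
  refine lintegral_mono_ae ?_
  filter_upwards [ae_productLaw hμ (n + 1)] with M hM
  gcongr
  exact detWeight_le hr hM

/-- For `s ≥ 2` the singular value function is multiplicative, so the integral factors. -/
theorem singValIntegral_of_two_le {s : ℝ} (hs : 2 ≤ s) (n : ℕ) :
    singValIntegral μ s n = (∫⁻ A, ((‖A.det‖₊ ^ (s / 2) : ℝ≥0) : ℝ≥0∞) ∂μ) ^ n := by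
  have hf : ∀ A : Mat, ENNReal.ofReal (singValFun s A) = ((‖A.det‖₊ ^ (s / 2) : ℝ≥0) : ℝ≥0∞) :=
    fun A => by
      rw [singValFun_of_two_le hs, ← ENNReal.ofReal_coe_nnreal, NNReal.coe_rpow, coe_nnnorm,
        Real.norm_eq_abs]
  have hm : Measurable fun A : Mat => ((‖A.det‖₊ ^ (s / 2) : ℝ≥0) : ℝ≥0∞) :=
    (continuous_nnnorm_det.measurable.pow_const _).coe_nnreal_ennreal
  simp only [singValIntegral, hf]
  induction n with
  | zero => rw [productLaw_zero, lintegral_dirac' _ hm]; simp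
  | succ n ih =>
    rw [lintegral_productLaw_succ _ _ hm, pow_succ', ← lintegral_mul_const _ hm]
    refine lintegral_congr fun A => ?_
    rw [← ih, ← lintegral_const_mul _ hm]
    refine lintegral_congr fun M => ?_
    rw [Matrix.det_mul, nnnorm_mul, NNReal.mul_rpow, ENNReal.coe_mul]

theorem pressure_of_two_le (hμ : ∀ᵐ A ∂μ, ‖planeMap A‖ ≤ 1) {s : ℝ} (hs : 2 ≤ s) :
    pressure μ s = ENNReal.log (∫⁻ A, ((‖A.det‖₊ ^ (s / 2) : ℝ≥0) : ℝ≥0∞) ∂μ) := by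
  rw [pressure_eq_iInf hμ (by linarith)]
  have : ∀ n : ℕ, pressureSeq μ s (n + 1) =
      ENNReal.log (∫⁻ A, ((‖A.det‖₊ ^ (s / 2) : ℝ≥0) : ℝ≥0∞) ∂μ) := fun n => by
    rw [pressureSeq_eq, singValIntegral_of_two_le hs, ENNReal.log_pow, ← EReal.mul_div]
    exact EReal.mul_div_cancel (EReal.natCast_ne_bot _) (EReal.natCast_ne_top _)
      (Nat.cast_ne_zero.2 n.succ_ne_zero)
  simp [this]

end DetWeight

/-! ### One-sided continuity in the exponent -/

noncomputable section ExponentContinuity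

variable {μ : Measure Mat} [IsFiniteMeasure μ]

theorem tendsto_singValIntegral_nhdsLT (hμ : ∀ᵐ A ∂μ, ‖planeMap A‖ ≤ 1) {s : ℝ} (hs : 0 < s)
    (n : ℕ) :
    Tendsto (fun s' => singValIntegral μ s' n) (𝓝[<] s) (𝓝 (singValIntegral μ s n)) := by
  have hpos : ∀ᶠ s' in 𝓝[<] s, 0 < s' :=
    eventually_nhdsWithin_of_eventually_nhds (lt_mem_nhds hs)
  refine tendsto_lintegral_filter_of_dominated_convergence (fun _ => 1) ?_ ?_ (by simp) ?_
  · filter_upwards [hpos] with s' h using measurable_ofReal_singValFun h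
  · filter_upwards [hpos] with s' h
    filter_upwards [ae_productLaw hμ n] with M hM
    exact ENNReal.ofReal_le_one.2 (singValFun_one_le_one h hM)
  · exact .of_forall fun M =>
      (ENNReal.continuous_ofReal.tendsto _).comp (tendsto_singValFun_nhdsLT hs M)

theorem pressureSeq_succ_lt_iff {ν : Measure Mat} {s : ℝ} {n : ℕ} {c : EReal} :
    pressureSeq ν s (n + 1) < c ↔
      ENNReal.log (singValIntegral ν s (n + 1)) < c * ((n + 1 : ℕ) : EReal) := by
  rw [pressureSeq_eq]
  exact EReal.div_lt_iff (by exact_mod_cast n.succ_pos) (EReal.natCast_ne_top _)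

theorem eventually_pressureSeq_lt (hμ : ∀ᵐ A ∂μ, ‖planeMap A‖ ≤ 1) {s : ℝ} (hs : 0 < s) {n : ℕ}
    {c : EReal} (hc : pressureSeq μ s (n + 1) < c) :
    ∀ᶠ s' in 𝓝[<] s, pressureSeq μ s' (n + 1) < c := by
  simp only [pressureSeq_succ_lt_iff] at hc ⊢
  exact ((ENNReal.continuous_log.tendsto _).comp
    (tendsto_singValIntegral_nhdsLT hμ hs (n + 1))).eventually (gt_mem_nhds hc)

theorem eventually_pressure_lt (hμ : ∀ᵐ A ∂μ, ‖planeMap A‖ ≤ 1) {s : ℝ} (hs : 0 < s)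
    {c : EReal} (hc : pressure μ s < c) : ∀ᶠ s' in 𝓝[<] s, pressure μ s' < c := by
  rw [pressure_eq_iInf hμ hs, iInf_lt_iff] at hc
  obtain ⟨n, hn⟩ := hc
  filter_upwards [eventually_pressureSeq_lt hμ hs hn,
    eventually_nhdsWithin_of_eventually_nhds (lt_mem_nhds hs)] with s' h hs'
  exact (pressure_le_pressureSeq hμ hs' n).trans_lt h

/-- Dominated convergence supplies the hypothesis `H` of `eventually_lt_pressure` when μ is fixed
and density and exponent vary. The densities need no continuity in `A`, so the indicator of the
invertible matrices is allowed as a limit. -/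
theorem tendsto_lintegral_comp_planeMap (hμ : ∀ᵐ A ∂μ, ‖planeMap A‖ ≤ 1) {ι : Type*} {l : Filter ι}
    [l.IsCountablyGenerated] {k : ι → Mat → ℝ≥0∞} {k₀ : Mat → ℝ≥0∞} (hkm : ∀ i, Measurable (k i))
    (hk₀m : Measurable k₀) (hk₀t : ∀ A, k₀ A ≠ ⊤)
    (hk : ∀ i, ∀ᵐ A ∂μ, k i A ≤ 1) (hk₀ : ∀ A, Tendsto (fun i => k i A) l (𝓝 (k₀ A)))
    {u : ι → ℝ} {t : ℝ} (ht : 0 < t) (hu : ∀ᶠ i in l, 0 < u i ∧ u i ≤ 1) (hut : Tendsto u l (𝓝 t))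
    {F : Plane → ℝ≥0} (hF : Continuous F) (v : Plane) :
    Tendsto (fun p : ι × Plane => ∫⁻ A, ((F (planeMap A p.2) ^ u p.1 : ℝ≥0) : ℝ≥0∞)
        ∂(μ.withDensity (k p.1))) (l ×ˢ 𝓝 v)
      (𝓝 (∫⁻ A, ((F (planeMap A v) ^ t : ℝ≥0) : ℝ≥0∞) ∂(μ.withDensity k₀))) := by
  have hm : ∀ (w : Plane) (x : ℝ), Measurable fun A : Mat =>
      ((F (planeMap A w) ^ x : ℝ≥0) : ℝ≥0∞) := fun w x =>
    ((hF.measurable.comp (measurable_planeMap_apply w)).pow_const _).coe_nnreal_ennreal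
  suffices h : Tendsto (fun p : ι × Plane => ∫⁻ A, k p.1 A *
      ((F (planeMap A p.2) ^ u p.1 : ℝ≥0) : ℝ≥0∞) ∂μ) (l ×ˢ 𝓝 v)
      (𝓝 (∫⁻ A, k₀ A * ((F (planeMap A v) ^ t : ℝ≥0) : ℝ≥0∞) ∂μ)) by
    rw [lintegral_withDensity_eq_lintegral_mul μ hk₀m (hm v t)]
    exact h.congr fun p => (lintegral_withDensity_eq_lintegral_mul μ (hkm p.1) (hm p.2 _)).symm
  obtain ⟨C, hC⟩ := ((isCompact_closedBall (0 : Plane) (‖v‖ + 1)).image hF).bddAbove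
  have hball : ∀ᶠ w : Plane in 𝓝 v, ‖w‖ < ‖v‖ + 1 :=
    continuous_norm.continuousAt.eventually_lt (continuousAt_const (y := ‖v‖ + 1)) (lt_add_one _)
  refine tendsto_lintegral_filter_of_dominated_convergence
    (fun _ => ((max C 1 : ℝ≥0) : ℝ≥0∞)) (.of_forall fun p => (hkm p.1).mul (hm p.2 _)) ?_ ?_ ?_
  · filter_upwards [hball.prod_inr l, hu.prod_inl (𝓝 v)] with p hp hup
    filter_upwards [hμ, hk p.1] with A hA hkA
    refine (mul_le_of_le_one_left' hkA).trans (ENNReal.coe_le_coe.2 ?_)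
    have h1 : F (planeMap A p.2) ≤ max C 1 := by
      refine le_max_of_le_left (hC ⟨_, ?_, rfl⟩)
      rw [mem_closedBall_zero_iff]
      exact le_trans (nnnorm_planeMap_apply_le hA p.2) hp.le
    refine (NNReal.rpow_le_rpow h1 hup.1.le).trans ?_
    exact (NNReal.rpow_le_rpow_of_exponent_le (le_max_right _ _) hup.2).trans_eq (NNReal.rpow_one _)
  · rw [lintegral_const]
    exact (ENNReal.mul_lt_top ENNReal.coe_lt_top (measure_lt_top _ _)).ne
  · refine .of_forall fun A => ?_
    refine ENNReal.Tendsto.mul ((hk₀ A).comp tendsto_fst) (Or.inr ENNReal.coe_ne_top)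
      (ENNReal.tendsto_coe.2 ?_) (Or.inr (hk₀t A))
    exact (NNReal.continuousAt_rpow (Or.inr ht)).tendsto.comp
        ((((hF.comp (planeMap A).continuous).tendsto v).comp tendsto_snd).prodMk_nhds
          (hut.comp tendsto_fst))

/-- Right-continuity of the pressure in the exponent, below the exponent one. -/
theorem eventually_lt_pressure_of_lt_one (hμ : ∀ᵐ A ∂μ, ‖planeMap A‖ ≤ 1) {s : ℝ} (hs : 0 < s)
    (hs1 : s < 1) {c : EReal} (hc : c < pressure μ s) : ∀ᶠ s' in 𝓝[>] s, c < pressure μ s' := by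
  have hu : ∀ᶠ s' : ℝ in 𝓝[>] s, 0 < s' ∧ s' ≤ 1 := eventually_nhdsWithin_of_eventually_nhds
    ((lt_mem_nhds hs).and ((gt_mem_nhds hs1).mono fun _ h => h.le))
  have hut : Tendsto (fun s' : ℝ => s') (𝓝[>] s) (𝓝 s) := nhdsWithin_le_nhds
  refine eventually_lt_pressure (κ := fun _ => μ) (fun _ => hμ) hu hμ hs hs1.le hut
    (fun F hF v => ?_) hc
  simpa using tendsto_lintegral_comp_planeMap hμ (k := fun _ => 1) (k₀ := 1)
    (fun _ => measurable_one) measurable_one (fun _ => ENNReal.one_ne_top) (fun _ => .of_forall fun _ => le_rfl)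
    (fun _ => tendsto_const_nhds) hs hu hut hF v

/-- Right limits of the pressure in the exponent, between the exponents one and two. -/
theorem eventually_lt_pressure_of_lt_two (hμ : ∀ᵐ A ∂μ, ‖planeMap A‖ ≤ 1) {s : ℝ} (hs : 1 ≤ s)
    (hs2 : s < 2) {c : EReal} (hc : c < pressure (detWeighted μ (s - 1)) (2 - s)) :
    ∀ᶠ s' in 𝓝[>] s, c < pressure μ s' := by
  have hmem : ∀ᶠ s' : ℝ in 𝓝[>] s, s < s' ∧ s' < 2 :=
    eventually_mem_nhdsWithin.and (eventually_nhdsWithin_of_eventually_nhds (gt_mem_nhds hs2))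
  have hu : ∀ᶠ s' : ℝ in 𝓝[>] s, 0 < 2 - s' ∧ 2 - s' ≤ 1 := by
    filter_upwards [hmem] with s' h
    constructor <;> linarith
  have hut : Tendsto (fun s' : ℝ => 2 - s') (𝓝[>] s) (𝓝 (2 - s)) :=
    tendsto_nhdsWithin_of_tendsto_nhds ((continuous_const.sub continuous_id).tendsto s)
  -- The absolute value keeps the weight bounded for every real parameter; it changes nothing for
  -- `s' > 1`.
  have hfin : ∀ r : ℝ, IsFiniteMeasure (detWeighted μ |r|) := fun r =>
    isFiniteMeasure_detWeighted hμ (abs_nonneg r)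
  have := isFiniteMeasure_detWeighted hμ (sub_nonneg.2 hs)
  have hev := eventually_lt_pressure (κ := fun s' : ℝ => detWeighted μ |s' - 1|) (t := 2 - s)
    (fun _ => ae_detWeighted hμ _) hu (ae_detWeighted hμ _) (by linarith) (by linarith) hut
    (fun F hF v => tendsto_lintegral_comp_planeMap hμ (k := fun s' => detWeight |s' - 1|)
      (k₀ := detWeight (s - 1)) (fun _ => measurable_detWeight _) (measurable_detWeight _)
      (detWeight_ne_top _) (fun _ => hμ.mono fun A hA => detWeight_le_one (abs_nonneg _) hA) (fun A => ?_)
      (by linarith) hu hut hF v) hc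
  · filter_upwards [hev, hmem] with s' h h'
    rw [pressure_eq_pressure_detWeighted hμ (by linarith) h'.2]
    rwa [abs_of_pos (by linarith)] at h
  · have h1 : Continuous fun s' : ℝ => detWeight |s' - 1| A :=
      (continuous_detWeight_exponent A).comp (by fun_prop)
    have h2 := h1.tendsto s
    rw [abs_of_nonneg (sub_nonneg.2 hs)] at h2
    exact h2.mono_left nhdsWithin_le_nhds

end ExponentContinuity

/-! ### Weak-* continuity on the ball and semicontinuity of the pressure -/

noncomputable section Ball

/-- Compactness of `Y` makes `G (x', ·)` uniformly close to `G (x, ·)`, and the measures have mass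
one; one δ is spent on the integrand and one on the measure. -/
theorem ENNReal.tendsto_lintegral_probabilityMeasure_prod {X Y : Type*} [TopologicalSpace X]
    [TopologicalSpace Y] [CompactSpace Y] [MeasurableSpace Y] [OpensMeasurableSpace Y]
    {G : X × Y → ℝ≥0} (hG : Continuous G) (μ : ProbabilityMeasure Y) (x : X) :
    Tendsto (fun p : ProbabilityMeasure Y × X => ∫⁻ y, (G (p.2, y) : ℝ≥0∞) ∂(p.1 : Measure Y))
      (𝓝 μ ×ˢ 𝓝 x) (𝓝 (∫⁻ y, (G (x, y) : ℝ≥0∞) ∂(μ : Measure Y))) := by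
  have hGx : ∀ z, Continuous fun y => G (z, y) := fun z => hG.comp (by fun_prop)
  have hbase : Tendsto (fun μ' : ProbabilityMeasure Y => ∫⁻ y, (G (x, y) : ℝ≥0∞) ∂(μ' : Measure Y))
      (𝓝 μ) (𝓝 (∫⁻ y, (G (x, y) : ℝ≥0∞) ∂(μ : Measure Y))) :=
    ProbabilityMeasure.tendsto_iff_forall_lintegral_tendsto.1 tendsto_id
      (BoundedContinuousFunction.mkOfCompact ⟨_, hGx x⟩)
  have hfin : ∫⁻ y, (G (x, y) : ℝ≥0∞) ∂(μ : Measure Y) ≠ ⊤ := by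
    obtain ⟨C, hC⟩ := (isCompact_range (hGx x)).bddAbove
    refine (lt_of_le_of_lt (lintegral_mono (g := fun _ => (C : ℝ≥0∞)) fun y =>
      ENNReal.coe_le_coe.2 (hC ⟨y, rfl⟩)) ?_).ne
    simp
  refine (ENNReal.tendsto_nhds hfin).2 fun ε hε => ?_
  obtain ⟨δ, hδ0, hδ⟩ : ∃ δ : ℝ≥0, 0 < δ ∧ (δ : ℝ≥0∞) + δ ≤ ε := by
    obtain ⟨δ, h1, h2⟩ := ENNReal.lt_iff_exists_nnreal_btwn.1 (ENNReal.half_pos hε.ne')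
    exact ⟨δ, by exact_mod_cast h1, (add_le_add h2.le h2.le).trans_eq (ENNReal.add_halves ε)⟩
  have hunif : ∀ᶠ x' in 𝓝 x, ∀ y ∈ (Set.univ : Set Y),
      G (x', y) < G (x, y) + δ ∧ G (x, y) < G (x', y) + δ := by
    refine isCompact_univ.eventually_forall_of_forall_eventually fun y _ => ?_
    have h1 : Continuous fun p : X × Y => G (x, p.2) := (hGx x).comp continuous_snd
    exact (hG.continuousAt.eventually_lt (h1.add continuous_const).continuousAt
      (lt_add_of_pos_right _ hδ0)).and
      (h1.continuousAt.eventually_lt (hG.add continuous_const).continuousAt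
      (lt_add_of_pos_right _ hδ0))
  filter_upwards [hunif.prod_inr (𝓝 μ), (((ENNReal.tendsto_nhds hfin).1 hbase) δ
    (by exact_mod_cast hδ0)).prod_inl (𝓝 x)] with p hp hp'
  have hint : ∀ f g : Y → ℝ≥0, (∀ y, f y < g y + δ) → ∫⁻ y, (f y : ℝ≥0∞) ∂(p.1 : Measure Y) ≤
      ∫⁻ y, (g y : ℝ≥0∞) ∂(p.1 : Measure Y) + δ := fun f g h => by
    calc _ ≤ ∫⁻ y, ((g y : ℝ≥0∞) + δ) ∂(p.1 : Measure Y) :=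
          lintegral_mono fun y => (ENNReal.coe_le_coe.2 (h y).le).trans_eq (ENNReal.coe_add _ _)
      _ = _ := by rw [lintegral_add_right _ measurable_const]; simp
  have h1 := hint _ _ fun y => (hp y trivial).1
  have h2 := hint _ _ fun y => (hp y trivial).2
  constructor
  · rw [tsub_le_iff_right]
    calc _ ≤ ∫⁻ y, (G (x, y) : ℝ≥0∞) ∂(p.1 : Measure Y) + δ := tsub_le_iff_right.1 hp'.1
      _ ≤ ∫⁻ y, (G (p.2, y) : ℝ≥0∞) ∂(p.1 : Measure Y) + δ + δ := by gcongr
      _ ≤ _ := by rw [add_assoc]; gcongr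
  · calc _ ≤ ∫⁻ y, (G (x, y) : ℝ≥0∞) ∂(p.1 : Measure Y) + δ := h1
      _ ≤ ∫⁻ y, (G (x, y) : ℝ≥0∞) ∂(μ : Measure Y) + δ + δ := by gcongr; exact hp'.2
      _ ≤ _ := by rw [add_assoc]; gcongr

instance : CompactSpace (matrixBall 2) := by
  let e : Mat ≃L[ℝ] (Plane →L[ℝ] Plane) :=
    (Matrix.toEuclideanCLM (n := Fin 2) (𝕜 := ℝ)).toAlgEquiv.toLinearEquiv.toContinuousLinearEquiv
  have : ProperSpace (Plane →L[ℝ] Plane) := FiniteDimensional.proper ℝ _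
  have h : matrixBall 2 = e ⁻¹' Metric.closedBall 0 1 := by
    ext A
    simp only [Set.mem_preimage, mem_closedBall_zero_iff]
    rfl
  rw [← isCompact_iff_compactSpace, h]
  exact e.toHomeomorph.isCompact_preimage.2 (isCompact_closedBall _ _)

theorem norm_planeMap_le_one (A : matrixBall 2) : ‖planeMap A.1‖ ≤ 1 := A.2

theorem measurableSet_matrixBall : MeasurableSet (matrixBall 2) :=
  (isClosed_le continuous_planeMap.norm continuous_const).measurableSet

instance (ν : Measure (matrixBall 2)) [IsFiniteMeasure ν] : IsFiniteMeasure (extendBall ν) := by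
  unfold extendBall; infer_instance

theorem ae_extendBall (ν : Measure (matrixBall 2)) : ∀ᵐ A ∂(extendBall ν), ‖planeMap A‖ ≤ 1 :=
  (ae_map_iff measurable_subtype_coe.aemeasurable measurableSet_matrixBall).2
    (.of_forall norm_planeMap_le_one)

theorem lintegral_extendBall (ν : Measure (matrixBall 2)) {g : Mat → ℝ≥0∞} (hg : Measurable g) :
    ∫⁻ A, g A ∂(extendBall ν) = ∫⁻ A, g A.1 ∂ν :=
  lintegral_map hg measurable_subtype_coe

theorem extendBall_invertiblePart (ν : Measure (matrixBall 2)) :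
    extendBall (invertiblePart ν) = detWeighted (extendBall ν) 0 := by
  have hdet : Measurable fun A : Mat => A.det := (Continuous.matrix_det continuous_id).measurable
  have hs : MeasurableSet {A : Mat | A.det ≠ 0} :=
    (hdet (measurableSet_singleton 0)).compl
  have hw : detWeight 0 = {A : Mat | A.det ≠ 0}.indicator 1 := by
    funext A
    by_cases h : A.det = 0 <;> simp [detWeight, h]
  rw [detWeighted, hw, withDensity_indicator_one hs, extendBall, extendBall, invertiblePart,
    Measure.restrict_map measurable_subtype_coe hs]
  rfl

theorem tendsto_singValIntegral_extendBall {s : ℝ} (hs : 0 < s) (n : ℕ)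
    (μ : ProbabilityMeasure (matrixBall 2)) :
    Tendsto (fun μ' : ProbabilityMeasure (matrixBall 2) =>
      singValIntegral (extendBall (μ' : Measure (matrixBall 2))) s n) (𝓝 μ)
      (𝓝 (singValIntegral (extendBall (μ : Measure (matrixBall 2))) s n)) := by
  set φ : (Fin n → matrixBall 2) → ℝ≥0 := fun A =>
    (singValFun s (List.ofFn fun i => (A i).1).prod).toNNReal with hφ
  have hcoe : Continuous fun (A : Fin n → matrixBall 2) (i : Fin n) => (A i).1 := by fun_prop
  have hφc : Continuous φ := continuous_real_toNNReal.comp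
    ((continuous_singValFun hs).comp ((continuous_prod_ofFn n).comp hcoe))
  have hint : ∀ μ' : ProbabilityMeasure (matrixBall 2),
      singValIntegral (extendBall (μ' : Measure (matrixBall 2))) s n =
        ∫⁻ A, (φ A : ℝ≥0∞) ∂(ProbabilityMeasure.pi fun _ : Fin n => μ' : Measure _) := fun μ' => by
    have hpi : (Measure.pi fun _ : Fin n => extendBall (μ' : Measure (matrixBall 2))) =
        (Measure.pi fun _ : Fin n => (μ' : Measure (matrixBall 2))).map
          fun A i => (A i).1 :=
      (Measure.pi_map_pi fun _ => measurable_subtype_coe.aemeasurable).symm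
    have hm : Measurable fun A : Fin n → Mat =>
        ENNReal.ofReal (singValFun s (List.ofFn A).prod) :=
      (measurable_ofReal_singValFun hs).comp (measurable_prod_ofFn n)
    rw [singValIntegral, productLaw, lintegral_map (measurable_ofReal_singValFun hs)
      (measurable_prod_ofFn n), hpi, lintegral_map hm hcoe.measurable]
    rfl
  simp only [hint]
  have hpc : Continuous fun μ' : ProbabilityMeasure (matrixBall 2) =>
      ProbabilityMeasure.pi fun _ : Fin n => μ' :=
    ProbabilityMeasure.continuous_pi.comp (continuous_pi fun _ => continuous_id)
  exact ProbabilityMeasure.tendsto_iff_forall_lintegral_tendsto.1 (hpc.tendsto μ)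
    (BoundedContinuousFunction.mkOfCompact ⟨φ, hφc⟩)

theorem eventually_pressureSeq_extendBall_lt {s : ℝ} (hs : 0 < s) {n : ℕ}
    {μ : ProbabilityMeasure (matrixBall 2)} {c : EReal}
    (hc : pressureSeq (extendBall (μ : Measure (matrixBall 2))) s (n + 1) < c) :
    ∀ᶠ μ' : ProbabilityMeasure (matrixBall 2) in 𝓝 μ,
      pressureSeq (extendBall (μ' : Measure (matrixBall 2))) s (n + 1) < c := by
  simp only [pressureSeq_succ_lt_iff] at hc ⊢
  exact ((ENNReal.continuous_log.tendsto _).comp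
    (tendsto_singValIntegral_extendBall hs (n + 1) μ)).eventually (gt_mem_nhds hc)

/-- Supplies the hypothesis `H` when the measure moves. Weak-* convergence needs a continuous
density, which the indicator of the invertible matrices is not; at `s = 1` one must therefore pass
to a larger exponent before perturbing μ⁰. -/
theorem tendsto_lintegral_extendBall {F : Plane → ℝ≥0} (hF : Continuous F) {t : ℝ} (ht : 0 < t)
    {k : Mat → ℝ≥0} (hk : Continuous k) (μ : ProbabilityMeasure (matrixBall 2)) (v : Plane) :
    Tendsto (fun p : ProbabilityMeasure (matrixBall 2) × Plane =>
      ∫⁻ A, ((F (planeMap A p.2) ^ t : ℝ≥0) : ℝ≥0∞)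
        ∂((extendBall (p.1 : Measure (matrixBall 2))).withDensity fun A => k A)) (𝓝 μ ×ˢ 𝓝 v)
      (𝓝 (∫⁻ A, ((F (planeMap A v) ^ t : ℝ≥0) : ℝ≥0∞)
        ∂((extendBall (μ : Measure (matrixBall 2))).withDensity fun A => k A))) := by
  have hkm : Measurable fun A : Mat => (k A : ℝ≥0∞) := hk.measurable.coe_nnreal_ennreal
  have hm : ∀ w : Plane, Measurable fun A : Mat => ((F (planeMap A w) ^ t : ℝ≥0) : ℝ≥0∞) :=
    fun w => ((hF.measurable.comp
      (measurable_planeMap_apply w)).pow_const _).coe_nnreal_ennreal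
  set G : Plane × matrixBall 2 → ℝ≥0 := fun p => k p.2.1 * F (planeMap p.2.1 p.1) ^ t with hG
  have hGc : Continuous G := by
    refine (hk.comp (by fun_prop)).mul ((NNReal.continuous_rpow_const ht.le).comp (hF.comp ?_))
    exact (continuous_planeMap.comp (by fun_prop)).clm_apply continuous_fst
  have hint : ∀ (μ' : ProbabilityMeasure (matrixBall 2)) (w : Plane),
      ∫⁻ A, ((F (planeMap A w) ^ t : ℝ≥0) : ℝ≥0∞)
        ∂((extendBall (μ' : Measure (matrixBall 2))).withDensity fun A => k A) =
      ∫⁻ A, (G (w, A) : ℝ≥0∞) ∂(μ' : Measure (matrixBall 2)) := fun μ' w => by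
    rw [lintegral_withDensity_eq_lintegral_mul _ hkm (hm w)]
    refine (lintegral_extendBall _ (hkm.mul (hm w))).trans (lintegral_congr fun A => ?_)
    simp [hG]
  rw [hint]
  exact (ENNReal.tendsto_lintegral_probabilityMeasure_prod hGc μ v).congr fun p =>
    (hint p.1 p.2).symm

theorem eventually_lt_pressure_extendBall_of_lt_one {s : ℝ} (hs : 0 < s) (hs1 : s < 1)
    {μ : ProbabilityMeasure (matrixBall 2)} {c : EReal}
    (hc : c < pressure (extendBall (μ : Measure (matrixBall 2))) s) :
    ∀ᶠ μ' : ProbabilityMeasure (matrixBall 2) in 𝓝 μ,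
      c < pressure (extendBall (μ' : Measure (matrixBall 2))) s := by
  refine eventually_lt_pressure
    (κ := fun μ' : ProbabilityMeasure (matrixBall 2) => extendBall (μ' : Measure (matrixBall 2)))
    (fun _ => ae_extendBall _) (u := fun _ => s) (.of_forall fun _ => ⟨hs, hs1.le⟩)
    (ae_extendBall _) hs hs1.le tendsto_const_nhds (fun F hF v => ?_) hc
  have := tendsto_lintegral_extendBall hF hs (k := fun _ => 1) continuous_const μ v
  have h1 : ∀ ν : Measure Mat, ν.withDensity (fun _ => ((1 : ℝ≥0) : ℝ≥0∞)) = ν := fun ν => by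
    simp
  simpa only [h1] using this

theorem eventually_lt_pressure_extendBall_of_lt_two {s : ℝ} (hs : 1 < s) (hs2 : s < 2)
    {μ : ProbabilityMeasure (matrixBall 2)} {c : EReal}
    (hc : c < pressure (extendBall (μ : Measure (matrixBall 2))) s) :
    ∀ᶠ μ' : ProbabilityMeasure (matrixBall 2) in 𝓝 μ,
      c < pressure (extendBall (μ' : Measure (matrixBall 2))) s := by
  have hfin : ∀ μ' : ProbabilityMeasure (matrixBall 2),
      IsFiniteMeasure (detWeighted (extendBall (μ' : Measure (matrixBall 2))) (s - 1)) := fun _ =>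
    isFiniteMeasure_detWeighted (ae_extendBall _) (by linarith)
  simp only [pressure_eq_pressure_detWeighted (ae_extendBall _) hs hs2] at hc ⊢
  refine eventually_lt_pressure
    (κ := fun μ' : ProbabilityMeasure (matrixBall 2) =>
      detWeighted (extendBall (μ' : Measure (matrixBall 2))) (s - 1))
    (fun _ => ae_detWeighted (ae_extendBall _) _) (u := fun _ => 2 - s)
    (.of_forall fun _ => ⟨by linarith, by linarith⟩)
    (ae_detWeighted (ae_extendBall _) _) (by linarith) (by linarith) tendsto_const_nhds
    (fun F hF v => ?_) hc
  have hr : 0 < s - 1 := by linarith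
  have hk : ∀ ν : Measure Mat, detWeighted ν (s - 1) =
      ν.withDensity fun A => ((‖A.det‖₊ ^ (s - 1) : ℝ≥0) : ℝ≥0∞) := fun ν => by
    rw [detWeighted, funext (detWeight_of_pos hr)]
  simp only [hk]
  exact tendsto_lintegral_extendBall hF (by linarith) (k := fun A => ‖A.det‖₊ ^ (s - 1))
    ((NNReal.continuous_rpow_const hr.le).comp continuous_nnnorm_det) μ v

theorem eventually_lt_pressure_extendBall_of_two_le {s : ℝ} (hs : 2 ≤ s)
    {μ : ProbabilityMeasure (matrixBall 2)} {c : EReal}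
    (hc : c < pressure (extendBall (μ : Measure (matrixBall 2))) s) :
    ∀ᶠ p : ProbabilityMeasure (matrixBall 2) × ℝ in 𝓝 (μ, s),
      c < pressure (extendBall (p.1 : Measure (matrixBall 2))) p.2 := by
  -- Clamping the exponent at 2 extends the explicit formula across `s = 2`; below 2 monotonicity in
  -- `s` makes the clamped pressure a lower bound.
  set G : ℝ × matrixBall 2 → ℝ≥0 := fun p => ‖p.2.1.det‖₊ ^ (max p.1 2 / 2) with hG
  have hGc : Continuous G := continuous_iff_continuousAt.2 fun p => by
    refine (NNReal.continuousAt_rpow (Or.inr ?_)).comp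
      (f := fun p : ℝ × matrixBall 2 => (‖p.2.1.det‖₊, max p.1 2 / 2)) ?_
    · have := le_max_right p.1 2
      positivity
    · exact ((continuous_nnnorm_det.comp (by fun_prop)).prodMk (by fun_prop)).continuousAt
  have hP : ∀ (μ' : ProbabilityMeasure (matrixBall 2)) (x : ℝ),
      pressure (extendBall (μ' : Measure (matrixBall 2))) (max x 2) =
        ENNReal.log (∫⁻ A, (G (x, A) : ℝ≥0∞) ∂(μ' : Measure (matrixBall 2))) := fun μ' x => by
    rw [pressure_of_two_le (ae_extendBall _) (le_max_right x 2), lintegral_extendBall]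
    exact (continuous_nnnorm_det.measurable.pow_const _).coe_nnreal_ennreal
  rw [← max_eq_left hs, hP] at hc
  rw [nhds_prod_eq]
  filter_upwards [((ENNReal.continuous_log.tendsto _).comp
    (ENNReal.tendsto_lintegral_probabilityMeasure_prod hGc μ s)).eventually (lt_mem_nhds hc),
    (lt_mem_nhds (show (0 : ℝ) < s by linarith)).prod_inr (𝓝 μ)] with p hp hp0
  rw [Function.comp_apply, ← hP] at hp
  exact hp.trans_le (pressure_antitone (ae_extendBall _) hp0 (le_max_left _ _))

/-- Upper semicontinuity of the pressure. -/
theorem eventually_pressure_extendBall_lt {s : ℝ} (hs : 0 < s)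
    {μ : ProbabilityMeasure (matrixBall 2)} {c : EReal}
    (hc : pressure (extendBall (μ : Measure (matrixBall 2))) s < c) :
    ∀ᶠ p : ProbabilityMeasure (matrixBall 2) × ℝ in 𝓝 (μ, s),
      pressure (extendBall (p.1 : Measure (matrixBall 2))) p.2 < c := by
  rw [pressure_eq_iInf (ae_extendBall _) hs, iInf_lt_iff] at hc
  obtain ⟨n, hn⟩ := hc
  -- An exponent `s₁ < s` where the `n`-th term is still below `c` handles all nearby exponents at
  -- once by monotonicity.
  obtain ⟨s₁, h1, h2, h3⟩ := ((eventually_pressureSeq_lt (ae_extendBall _) hs hn).and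
    (eventually_mem_nhdsWithin.and
      (eventually_nhdsWithin_of_eventually_nhds (lt_mem_nhds hs)))).exists
  rw [nhds_prod_eq]
  filter_upwards [(eventually_pressureSeq_extendBall_lt h3 h1).prod_inl (𝓝 s),
    (lt_mem_nhds h2).prod_inr (𝓝 μ)] with p hp hp1
  refine (pressure_antitone (ae_extendBall _) h3 hp1.le).trans_lt ?_
  exact (pressure_le_pressureSeq (ae_extendBall _) h3 n).trans_lt hp

/-- Lower semicontinuity of the pressure away from the exponent one, and at the exponent one for
measures whose singular matrices do not contribute to the pressure. -/
theorem eventually_lt_pressure_extendBall {s : ℝ} (hs : 0 < s)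
    {μ : ProbabilityMeasure (matrixBall 2)}
    (hμ : s = 1 → pressure (extendBall (μ : Measure (matrixBall 2))) 1 ≤
      pressure (extendBall (invertiblePart (μ : Measure (matrixBall 2)))) 1) {c : EReal}
    (hc : c < pressure (extendBall (μ : Measure (matrixBall 2))) s) :
    ∀ᶠ p : ProbabilityMeasure (matrixBall 2) × ℝ in 𝓝 (μ, s),
      c < pressure (extendBall (p.1 : Measure (matrixBall 2))) p.2 := by
  rcases le_or_gt 2 s with h2 | h2
  · exact eventually_lt_pressure_extendBall_of_two_le h2 hc
  -- Dually, a lower bound at a fixed `s₁ > s` passes to every exponent below `s₁`.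
  suffices h : ∃ s₁ > s, ∀ᶠ μ' : ProbabilityMeasure (matrixBall 2) in 𝓝 μ,
      c < pressure (extendBall (μ' : Measure (matrixBall 2))) s₁ by
    obtain ⟨s₁, h1, h3⟩ := h
    rw [nhds_prod_eq]
    filter_upwards [h3.prod_inl (𝓝 s), (gt_mem_nhds h1).prod_inr (𝓝 μ),
      (lt_mem_nhds hs).prod_inr (𝓝 μ)] with p hp hp1 hp0
    exact hp.trans_le (pressure_antitone (ae_extendBall _) hp0 hp1.le)
  rcases lt_or_ge s 1 with h1 | h1
  · obtain ⟨s₁, h3, h4, h5⟩ := ((eventually_lt_pressure_of_lt_one (ae_extendBall _) hs h1 hc).and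
      (eventually_mem_nhdsWithin.and
        (eventually_nhdsWithin_of_eventually_nhds (gt_mem_nhds h1)))).exists
    exact ⟨s₁, h4, eventually_lt_pressure_extendBall_of_lt_one (hs.trans h4) h5 h3⟩
  · have hc' : c < pressure (detWeighted (extendBall (μ : Measure (matrixBall 2))) (s - 1))
        (2 - s) := by
      -- Only at `s = 1` does the right limit, the pressure of μ⁰, require the hypothesis on
      -- singular matrices.
      rcases h1.eq_or_lt with rfl | h1
      · refine hc.trans_le ((hμ rfl).trans_eq ?_)
        rw [extendBall_invertiblePart, sub_self]
        norm_num
      · rwa [← pressure_eq_pressure_detWeighted (ae_extendBall _) h1 h2]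
    obtain ⟨s₁, h3, h4, h5⟩ := ((eventually_lt_pressure_of_lt_two (ae_extendBall _) h1 h2 hc').and
      (eventually_mem_nhdsWithin.and
        (eventually_nhdsWithin_of_eventually_nhds (gt_mem_nhds h2)))).exists
    exact ⟨s₁, h4, eventually_lt_pressure_extendBall_of_lt_two (h1.trans_lt h4) h5 h3⟩

/-- Just above the exponent one, singular matrices do not contribute to the pressure. -/
theorem eventually_pressure_lt_of_invertiblePart {μ : ProbabilityMeasure (matrixBall 2)} {c : EReal}
    (hc : pressure (extendBall (invertiblePart (μ : Measure (matrixBall 2)))) 1 < c) :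
    ∀ᶠ s in 𝓝[>] (1 : ℝ), pressure (extendBall (μ : Measure (matrixBall 2))) s < c := by
  rw [extendBall_invertiblePart] at hc
  have := isFiniteMeasure_detWeighted (ae_extendBall (μ : Measure (matrixBall 2))) le_rfl
  have h1 := eventually_pressure_lt (ae_detWeighted (ae_extendBall _) 0) one_pos hc
  have h2 : Tendsto (fun s : ℝ => 2 - s) (𝓝[>] 1) (𝓝[<] 1) := by
    refine tendsto_nhdsWithin_iff.2 ⟨?_, ?_⟩
    · exact tendsto_nhdsWithin_of_tendsto_nhds
        ((continuous_const.sub continuous_id).tendsto' 1 1 (by norm_num))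
    · filter_upwards [eventually_mem_nhdsWithin] with s (hs : 1 < s)
      exact show 2 - s < 1 by linarith
  filter_upwards [h2.eventually h1, eventually_mem_nhdsWithin,
    eventually_nhdsWithin_of_eventually_nhds (gt_mem_nhds one_lt_two)] with s h3 (h4 : 1 < s) h5
  rw [pressure_eq_pressure_detWeighted (ae_extendBall _) h4 h5]
  exact (pressure_detWeighted_le (ae_extendBall _) (by linarith) (by linarith)).trans_lt h3

end Ball

/-! ### The set of discontinuities -/

theorem mainTheorem5 :
    (∀ (ν : Measure (matrixBall 2)) [IsFiniteMeasure ν] (s : ℝ), 0 < s →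
      Tendsto (pressureSeq (extendBall ν) s) atTop (𝓝 (pressure (extendBall ν) s)) ∧
        pressure (extendBall ν) s < ⊤) ∧
    ∀ (μ : ProbabilityMeasure (matrixBall 2)) (s : Set.Ioi (0 : ℝ)),
      ¬ ContinuousAt
          (fun p : ProbabilityMeasure (matrixBall 2) × Set.Ioi (0 : ℝ) =>
            pressure (extendBall (p.1 : Measure (matrixBall 2))) (p.2 : ℝ)) (μ, s) ↔
        (s : ℝ) = 1 ∧
          pressure (extendBall (invertiblePart (μ : Measure (matrixBall 2)))) 1 <
            pressure (extendBall (μ : Measure (matrixBall 2))) 1 := by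
  refine ⟨fun ν _ s hs => ⟨tendsto_pressureSeq (ae_extendBall ν) hs,
    pressure_lt_top (ae_extendBall ν) hs⟩, fun μ s => ?_⟩
  obtain ⟨s, hs⟩ := s
  have hs0 : 0 < s := hs
  have hval : Tendsto (fun p : ProbabilityMeasure (matrixBall 2) × Set.Ioi (0 : ℝ) =>
      (p.1, (p.2 : ℝ))) (𝓝 (μ, ⟨s, hs⟩)) (𝓝 (μ, s)) :=
    (continuous_fst.prodMk (continuous_subtype_val.comp continuous_snd)).tendsto _
  constructor
  · intro hdisc
    by_contra! hcon
    refine hdisc (tendsto_order.2 ⟨fun c hc => ?_, fun c hc => ?_⟩)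
    · exact hval.eventually (eventually_lt_pressure_extendBall hs0 hcon hc)
    · exact hval.eventually (eventually_pressure_extendBall_lt hs0 hc)
  · rintro ⟨h1, hlt⟩ hcont
    change s = 1 at h1
    subst h1
    -- With μ fixed, exponents just above 1 already violate continuity: there the pressure lies
    -- below `c`, while its value at 1 lies above.
    obtain ⟨c, hc1, hc2⟩ := exists_between hlt
    have h2 : ∀ᶠ x : Set.Ioi (0 : ℝ) in 𝓝 ⟨1, hs⟩,
        c < pressure (extendBall (μ : Measure (matrixBall 2))) (x : ℝ) :=
      (hcont.comp (f := fun x : Set.Ioi (0 : ℝ) => (μ, x)) (by fun_prop)).eventually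
        (lt_mem_nhds hc2)
    have h3 : ∀ᶠ x : ℝ in 𝓝 1, c < pressure (extendBall (μ : Measure (matrixBall 2))) x := by
      rw [← isOpen_Ioi.isOpenEmbedding_subtypeVal.map_nhds_eq ⟨1, hs⟩]
      exact h2
    obtain ⟨x, h4, h5⟩ := ((eventually_pressure_lt_of_invertiblePart hc1).and
      (eventually_nhdsWithin_of_eventually_nhds h3)).exists
    exact lt_asymm h4 h5
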